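/- Let $n\ge 1$ items be labelled $1,\dots,n$ by their true rank and have real random parameters $\theta_1,\dots,\theta_n$ distributed as consecutive points, in decreasing order, of a Poisson point process of rate $\lambda>0$; that is, the gaps $X_i=\theta_i-\theta_{i+1}$, $1\le i\le n-1$, are i.i.d. exponential random variables of rate $\lambda$ (mean $1/\lambda$). A comparison of item $i$ with item $j$ is random and, conditionally on $\theta$ and independently of all other comparisons, follows the Bradley--Terry model: $i$ is preferred to $j$ (written $i\prec j$) with probability $$\frac{e^{\theta_i}}{e^{\theta_i}+e^{\theta_j}}=\frac1{1+e^{-(\theta_i-\theta_j)}} .$$ Randomized Quicksort applied to a set $S$ of items returns the list of $S$ if $|S|<2$; otherwise it draws a pivot $p\in S$ uniformly at random, compares every $i\in S\setminus\{p\}$ with $p$, puts $i$ into $L$ if the outcome is $i\prec p$ and into $R$ otherwise, and returns $\mathrm{Quicksort}(L)\cdot p\cdot\mathrm{Quicksort}(R)$. Let $\sigma(i)$ be the position of item $i$ in the output of randomized Quicksort applied to $\{1,\dots,n\}$, and let $$\Delta(\sigma)=\frac1n\sum_{i=1}^n|\sigma(i)-i|$$ be the average displacement. Theorem. There are absolute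 constants $C,c,\alpha>0$ such that for all $\lambda>0$ and all $n\ge1$ $$\mathbf P\bigl(\Delta(\sigma)\le C\max\{1,\lambda\}^3\bigr)\ \ge\ 1-\frac{c}{n^{\alpha}},$$ where the probability is over $\theta$, the outcomes of the comparisons and the choices of the pivots. In particular, for $\lambda\ge1$, $\Delta(\sigma)\le C\lambda^3$ with high probability, i.e. $\Delta(\sigma)=O(\lambda^3)$. -/

import Mathlib

open MeasureTheory ProbabilityTheory
open scoped ENNReal

namespace NoisySort

noncomputable section

/-- The outcome of one comparison of item `i` with item `j` in the Bradley-Terry model with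
parameters `θ`: `true` means that `i` is preferred to `j` (written `i ≺ j`), and this has
probability `exp (θ i) / (exp (θ i) + exp (θ j))`. -/
def btCompare {ι : Type*} (θ : ι → ℝ) (i j : ι) : PMF Bool :=
  PMF.ofFintype
    (fun b => ENNReal.ofReal
      (if b then Real.exp (θ i) / (Real.exp (θ i) + Real.exp (θ j))
        else Real.exp (θ j) / (Real.exp (θ i) + Real.exp (θ j))))
    (by
      have hpos : 0 < Real.exp (θ i) + Real.exp (θ j) := by positivity
      rw [Fintype.sum_bool, ← ENNReal.ofReal_add (by simp; positivity) (by simp; positivity)]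
      simp [← add_div, div_self hpos.ne'])

/-- The partition operation. Every item `i` of the list is compared with the pivot `p`, by a fresh
independent comparison; the items with `i ≺ p` go to the first part, the others to the second.
The value is the law of the two parts, which always split the given list. -/
def partition {ι : Type*} (cmp : ι → ι → PMF Bool) (p : ι) :
    (S : List ι) → PMF {LR : List ι × List ι // (LR.1 ++ LR.2).Perm S}
  | [] => PMF.pure ⟨([], []), List.Perm.nil⟩
  | i :: S =>
    (cmp i p).bind fun b =>
      (partition cmp p S).map fun LR =>
        if b then ⟨(i :: LR.1.1, LR.1.2), LR.2.cons i⟩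
        else ⟨(LR.1.1, i :: LR.1.2), List.perm_middle.trans (LR.2.cons i)⟩

/-- Randomized Quicksort, where `cmp i j` is the law of the outcome of a comparison of `i` and `j`.
A set of items is given as a list of its elements. If there are at least two of them, then a pivot
is drawn uniformly at random, the other items are partitioned by comparing them with the pivot, and
the two parts are sorted recursively. The value is the law of the output. -/
def quicksort {ι : Type*} (cmp : ι → ι → PMF Bool) (S : List ι) : PMF (List ι) :=
  if h : S.length < 2 then PMF.pure S
  else
    haveI : Nonempty (Fin S.length) := ⟨⟨0, by omega⟩⟩
    (PMF.uniformOfFintype (Fin S.length)).bind fun k =>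
      (partition cmp (S.get k) (S.eraseIdx k)).bind fun LR =>
        (quicksort cmp LR.1.1).bind fun l =>
          (quicksort cmp LR.1.2).map fun r => l ++ S.get k :: r
termination_by S.length
decreasing_by
  all_goals
    have h1 := LR.2.length_eq
    have h2 := List.length_eraseIdx_of_lt k.isLt
    simp only [List.length_append] at h1
    omega

/-- The rank `σ(i) ∈ {1, …, n}` of item `i` in the ranking listed by `l`, best item first. -/
def rank {n : ℕ} (l : List (Fin n)) (i : Fin n) : ℕ := l.idxOf i + 1

/-- The average displacement `Δ(σ) = (1/n) ∑ᵢ |σ(i) - i|` of the ranking listed by `l`. The items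
are labelled by their true ranks, so the true rank of `i : Fin n` is `i + 1`. -/
def avgDisplacement {n : ℕ} (l : List (Fin n)) : ℝ :=
  (1 / (n : ℝ)) * ∑ i : Fin n, |(rank l i : ℝ) - ((i : ℕ) + 1 : ℝ)|

/-- The gap `θᵢ - θᵢ₊₁` between the parameters of two consecutive items. -/
def gap {n : ℕ} (θ : Fin n → ℝ) (i : Fin (n - 1)) : ℝ :=
  θ ⟨i, by omega⟩ - θ ⟨i + 1, by omega⟩

/-- The probability that the output of randomized Quicksort, run on all `n` items with Bradley-Terry
comparisons with the random parameters `θ`, satisfies the predicate `E`. The probability is over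
`θ` (defined on the probability space `(Ω, P)`), the outcomes of the comparisons and the choices of
the pivots: it is the expectation over `θ` of the conditional probability given `θ`. -/
def quicksortProb {Ω : Type*} [MeasurableSpace Ω] (P : Measure Ω) {n : ℕ} (θ : Ω → Fin n → ℝ)
    (E : List (Fin n) → Prop) : ℝ≥0∞ :=
  ∫⁻ ω, (quicksort (btCompare (θ ω)) (List.finRange n)).toOuterMeasure {l | E l} ∂P

end

end NoisySort

/-!
The displacement of an item is at most the number of inversions of the output that it takes part
in, and each inversion has two entries, so the average displacement is at most `2 * I / n`, where
`I` is the number of inversions of the output (`avgDisplacement_le`). It remains to show that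
`I = O(Λ ^ 3 * n)` with high probability, where `Λ = max 1 rate`.

*Fixed parameters.* Inversions are created one recursion step at a time: the output `l ++ p :: r`
has the inversions of `l`, those of `r`, and the cross inversions caused by wrong outcomes of
comparisons with the pivot `p`. Whatever set `p` is the pivot of, the mean number of
cross inversions is at most `pivotCost θ p`, an explicit sum of exponentials of
differences of parameters. Since every item is a pivot at most once and the two recursive calls are independent, the mean of a function `G` of the
output that is submultiplicative along the recursion is at most a product over all items
(`mean_quicksort_le`). This is applied to `G = min A (exp (s * I))`. The cap `A` makes it harmless
that a pivot can create very many inversions: unless an item at least `K` ranks away from the pivot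
is put on the wrong side, a pivot creates at most `3 * K ^ 2` inversions and the exponential is
comparable to its linear approximation; the exceptional case has probability at most
`farCost θ K p`. Hence `I` exceeds a multiple of `∑ p, pivotCost θ p` with small probability only
(`quicksort_avgDisplacement`).

*Random parameters.* The factor `exp (-(θ i - θ p))` splits at each `j` between `i` and `p`, so that
`∑ p, pivotCost θ p` is at most `3 * ∑ j, V j * W j`, where `V j` is the sum of `exp (-(θ i - θ j))`
over `i ≤ j` and `W j` is the sum of `exp (-(θ j - θ p))` over `p ≥ j` (`sum_pivotCost_le`). Both
sequences solve a recursion `v (k + 1) = 1 + y k * v k`, one of them after reversal of the items,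
where the factors `y k` are the independent variables `exp (-gap)`. Their moments satisfy
`E (y k) ^ j ≤ Λ / (Λ + j)`. By convexity the recursion contracts the second and the fourth moment,
and the sum of the squares `v k ^ 2` is controlled by a martingale with orthogonal increments.
Chebyshev's inequality gives a bound `O(Λ ^ 3 * n)`, up to probability `O(1 / n)`
(`IsFactorSequence.measure_sum_chain_sq_le`). The sum of `farCost θ K p` has mean at most
`2 * n ^ 2 * (Λ / (Λ + 1)) ^ K`, which is negligible for `K` of order `Λ * n ^ (1 / 4)`.
-/

namespace NoisySort

/-! ### Means under discrete laws and the quicksort recursion -/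

/-- The expectation of a nonnegative extended real function under a discrete law. -/
noncomputable def mean {α : Type*} (μ : PMF α) (f : α → ℝ≥0∞) : ℝ≥0∞ := ∑' a, μ a * f a

section Mean

variable {α β : Type*}

lemma mean_pure (a : α) (f : α → ℝ≥0∞) : mean (PMF.pure a) f = f a := by
  classical
  rw [mean, tsum_eq_single a]
  · simp
  · intro b hb
    simp [hb]

lemma mean_bind (μ : PMF α) (ν : α → PMF β) (f : β → ℝ≥0∞) :
    mean (μ.bind ν) f = mean μ fun a => mean (ν a) f := by
  simp only [mean, PMF.bind_apply, ← ENNReal.tsum_mul_right, ← ENNReal.tsum_mul_left]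
  rw [ENNReal.tsum_comm]
  simp only [mul_assoc]

lemma mean_map (μ : PMF α) (φ : α → β) (f : β → ℝ≥0∞) :
    mean (μ.map φ) f = mean μ fun a => f (φ a) := by
  rw [PMF.map, mean_bind]
  simp [mean_pure]

lemma mean_mono {μ : PMF α} {f g : α → ℝ≥0∞} (h : ∀ a, μ a ≠ 0 → f a ≤ g a) :
    mean μ f ≤ mean μ g := by
  refine ENNReal.tsum_le_tsum fun a => ?_
  by_cases ha : μ a = 0
  · simp [ha]
  · gcongr
    exact h a ha

lemma mean_add (μ : PMF α) (f g : α → ℝ≥0∞) :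
    mean μ (fun a => f a + g a) = mean μ f + mean μ g := by
  simp only [mean, mul_add, ENNReal.tsum_add]

lemma mean_const_mul (μ : PMF α) (c : ℝ≥0∞) (f : α → ℝ≥0∞) :
    mean μ (fun a => c * f a) = c * mean μ f := by
  simp only [mean, mul_left_comm _ c, ENNReal.tsum_mul_left]

lemma mean_mul_const (μ : PMF α) (c : ℝ≥0∞) (f : α → ℝ≥0∞) :
    mean μ (fun a => f a * c) = mean μ f * c := by
  simp only [mean, ← mul_assoc, ENNReal.tsum_mul_right]

lemma mean_const (μ : PMF α) (c : ℝ≥0∞) : mean μ (fun _ => c) = c := by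
  simp [mean, ENNReal.tsum_mul_right, PMF.tsum_coe]

lemma mean_bool (μ : PMF Bool) (f : Bool → ℝ≥0∞) :
    mean μ f = μ true * f true + μ false * f false := by
  simp [mean, tsum_fintype]

lemma toOuterMeasure_eq_mean (μ : PMF α) (E : Set α) :
    μ.toOuterMeasure E = mean μ (E.indicator 1) := by
  rw [PMF.toOuterMeasure_apply, mean]
  refine tsum_congr fun a => ?_
  by_cases ha : a ∈ E <;> simp [ha]

/-- Markov's inequality, in the form of a lower bound for the probability of the complement. -/
lemma one_sub_le_toOuterMeasure (μ : PMF α) (E : Set α) (f : α → ℝ≥0∞)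
    (h : ∀ a, μ a ≠ 0 → a ∉ E → 1 ≤ f a) : 1 - mean μ f ≤ μ.toOuterMeasure E := by
  rw [toOuterMeasure_eq_mean, tsub_le_iff_right, ← mean_add, ← mean_const μ 1]
  refine mean_mono fun a ha => ?_
  by_cases haE : a ∈ E
  · simp [haE]
  · simpa [haE] using h a ha haE

end Mean

section Quicksort

variable {ι : Type*}

lemma quicksort_perm (cmp : ι → ι → PMF Bool) (S : List ι) :
    ∀ l, quicksort cmp S l ≠ 0 → l.Perm S := by
  induction hN : S.length using Nat.strong_induction_on generalizing S with
  | _ N ih =>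
    subst hN
    intro l hl
    rw [quicksort] at hl
    split_ifs at hl with h
    · have := (PMF.mem_support_pure_iff _ _).1 ((PMF.mem_support_iff _ _).2 hl)
      rw [this]
    · rw [← PMF.mem_support_iff] at hl
      simp only [PMF.mem_support_bind_iff, PMF.mem_support_map_iff] at hl
      obtain ⟨k, -, LR, -, l₁, h₁, l₂, h₂, rfl⟩ := hl
      have e1 := LR.2.length_eq
      have e2 := List.length_eraseIdx_of_lt k.isLt
      simp only [List.length_append] at e1
      have p₁ := ih _ (by omega) LR.1.1 rfl l₁ h₁
      have p₂ := ih _ (by omega) LR.1.2 rfl l₂ h₂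
      have := List.getElem_cons_eraseIdx_perm k.isLt
      exact List.perm_middle.trans ((((p₁.append p₂).trans LR.2).cons _).trans this)

/-- Exponential moments of quicksort. If `G` is submultiplicative along one recursion step, up to a
factor `g` whose mean over the outcomes of the comparisons with the pivot `p` is at most `w p`
whatever the set to be sorted is, then the mean of `G` over the output is at most the product of
`w p` over all items `p`: every item is a pivot at most once, and the two recursive calls are
independent. -/
theorem mean_quicksort_le (cmp : ι → ι → PMF Bool) (G : List ι → ℝ≥0∞) (w : ι → ℝ≥0∞)
    (g : ι → List ι → List ι → ℝ≥0∞) (hG0 : ∀ S : List ι, S.length < 2 → G S ≤ 1)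
    (hw : ∀ p, 1 ≤ w p)
    (hG : ∀ p l r L R, l.Perm L → r.Perm R → G (l ++ p :: r) ≤ g p L R * (G l * G r))
    (hg : ∀ p S, (p :: S).Nodup →
      mean (partition cmp p S) (fun LR => g p LR.1.1 LR.1.2) ≤ w p)
    (S : List ι) (hS : S.Nodup) : mean (quicksort cmp S) G ≤ (S.map w).prod := by
  induction hN : S.length using Nat.strong_induction_on generalizing S with
  | _ N ih =>
    subst hN
    rw [quicksort]
    split_ifs with h
    · rw [mean_pure]
      refine (hG0 S h).trans (List.one_le_prod_of_one_le ?_)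
      simp only [List.mem_map]
      rintro _ ⟨p, -, rfl⟩
      exact hw p
    · rw [mean_bind]
      refine (mean_mono fun k _ => ?_).trans_eq (mean_const _ _)
      have hperm := List.getElem_cons_eraseIdx_perm k.isLt
      have hnd : (S.get k :: S.eraseIdx k).Nodup := hperm.nodup_iff.2 hS
      rw [mean_bind, ← (hperm.map w).prod_eq, List.map_cons, List.prod_cons]
      refine le_trans ?_ (mul_le_mul_left (hg _ _ hnd) _)
      rw [← mean_mul_const]
      refine mean_mono fun LR _ => ?_
      have e1 := LR.2.length_eq
      have e2 := List.length_eraseIdx_of_lt k.isLt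
      simp only [List.length_append] at e1
      have hndLR := LR.2.nodup_iff.2 hnd.of_cons
      have i₁ := ih _ (by omega) LR.1.1 hndLR.of_append_left rfl
      have i₂ := ih _ (by omega) LR.1.2 hndLR.of_append_right rfl
      rw [← (LR.2.map w).prod_eq, List.map_append, List.prod_append]
      refine le_trans ?_ (mul_le_mul_right (mul_le_mul' i₁ i₂) _)
      rw [mean_bind, ← mean_mul_const, ← mean_const_mul]
      refine mean_mono fun l hl => ?_
      rw [mean_map, ← mean_const_mul, ← mean_const_mul]
      exact mean_mono fun r hr =>
        hG _ _ _ _ _ (quicksort_perm cmp _ l hl) (quicksort_perm cmp _ r hr)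

/-- The total weight of the items of the second part has mean the sum of the weights, each
multiplied by the probability that the item loses its comparison. -/
lemma mean_partition_snd (cmp : ι → ι → PMF Bool) (p : ι) (a : ι → ℝ≥0∞) (S : List ι) :
    mean (partition cmp p S) (fun LR => (LR.1.2.map a).sum) =
      (S.map fun i => cmp i p false * a i).sum := by
  induction S with
  | nil => simp [partition, mean_pure]
  | cons i S ih =>
    have h1 := (cmp i p).tsum_coe
    rw [tsum_fintype, Fintype.sum_bool] at h1
    simp only [partition, mean_bind, mean_map, mean_bool]
    simp only [if_true, Bool.false_eq_true, if_false, List.map_cons, List.sum_cons, mean_add,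
      mean_const, ih, mul_add]
    rw [add_left_comm, ← add_mul, h1, one_mul]

lemma mean_partition_fst (cmp : ι → ι → PMF Bool) (p : ι) (b : ι → ℝ≥0∞) (S : List ι) :
    mean (partition cmp p S) (fun LR => (LR.1.1.map b).sum) =
      (S.map fun i => cmp i p true * b i).sum := by
  induction S with
  | nil => simp [partition, mean_pure]
  | cons i S ih =>
    have h1 := (cmp i p).tsum_coe
    rw [tsum_fintype, Fintype.sum_bool] at h1
    simp only [partition, mean_bind, mean_map, mean_bool]
    simp only [if_true, Bool.false_eq_true, if_false, List.map_cons, List.sum_cons, mean_add,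
      mean_const, ih, mul_add]
    rw [add_assoc, ← add_mul, h1, one_mul]

/-- The weights of the two parts are negatively correlated: different comparisons are independent,
and an item lies in only one of the parts. -/
lemma mean_partition_mul_le (cmp : ι → ι → PMF Bool) (p : ι) (a b : ι → ℝ≥0∞) (S : List ι) :
    mean (partition cmp p S) (fun LR => (LR.1.2.map a).sum * (LR.1.1.map b).sum) ≤
      (S.map fun i => cmp i p false * a i).sum * (S.map fun i => cmp i p true * b i).sum := by
  induction S with
  | nil => simp [partition, mean_pure]
  | cons i S ih =>
    have h1 := (cmp i p).tsum_coe
    rw [tsum_fintype, Fintype.sum_bool] at h1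
    simp only [partition, mean_bind, mean_map, mean_bool]
    simp only [if_true, Bool.false_eq_true, if_false, List.map_cons, List.sum_cons, mul_add,
      add_mul, mean_add, mean_const_mul, mean_mul_const, mean_partition_fst, mean_partition_snd]
    set u := cmp i p true
    set v := cmp i p false
    set A := (S.map fun i => cmp i p false * a i).sum
    set B := (S.map fun i => cmp i p true * b i).sum
    set Z := mean (partition cmp p S) (fun LR => (LR.1.2.map a).sum * (LR.1.1.map b).sum)
    calc u * (A * b i) + u * Z + (v * (a i * B) + v * Z)
        = (u + v) * Z + (A * (u * b i) + v * a i * B) := by ring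
      _ ≤ A * B + (A * (u * b i) + v * a i * B) := by rw [h1, one_mul]; gcongr
      _ ≤ v * a i * (u * b i) + (A * (u * b i) + v * a i * B) + A * B := by
        rw [add_comm (A * B)]; exact add_le_add le_add_self le_rfl
      _ = _ := by ring

end Quicksort

/-! ### Inversions and displacement -/

section Inversions

variable {ι : Type*} [LinearOrder ι]

/-- The number of inversions of a list: of pairs of entries of which the larger comes first. -/
def inversions : List ι → ℕ
  | [] => 0
  | a :: l => l.countP (· < a) + inversions l

/-- The number of inversions of `L ++ p :: R` that are not inversions of `L` or of `R`. -/
def crossInversions (p : ι) (L R : List ι) : ℕ :=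
  R.countP (· < p) + (L.map fun j => (p :: R).countP (· < j)).sum

lemma inversions_append (l r : List ι) :
    inversions (l ++ r) =
      inversions l + inversions r + (l.map fun j => r.countP (· < j)).sum := by
  induction l with
  | nil => simp [inversions]
  | cons a l ih =>
    simp only [List.cons_append, inversions, ih, List.countP_append, List.map_cons, List.sum_cons]
    ring

lemma inversions_append_cons (p : ι) {l r L R : List ι} (hl : l.Perm L) (hr : r.Perm R) :
    inversions (l ++ p :: r) = crossInversions p L R + (inversions l + inversions r) := by
  have h1 : ∀ j, (p :: r).countP (· < j) = (p :: R).countP (· < j) := fun j =>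
    (hr.cons p).countP_eq _
  rw [inversions_append, inversions, crossInversions, hr.countP_eq]
  simp only [h1, (hl.map fun j => (p :: R).countP (· < j)).sum_eq]
  ring

/-- The distance between the position of an entry and the number of smaller entries is at most the
number of inversions that the entry takes part in, and each inversion has two entries. -/
lemma sum_abs_idxOf_sub_countP_le (l : List ι) (hl : l.Nodup) :
    (l.map fun i => |(l.idxOf i : ℝ) - l.countP (· < i)|).sum ≤ 2 * inversions l := by
  induction l with
  | nil => simp [inversions]
  | cons a l ih =>
    have ha := (List.nodup_cons.1 hl).1
    specialize ih hl.of_cons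
    have key : (l.map fun i => |((a :: l).idxOf i : ℝ) - (a :: l).countP (· < i)|).sum ≤
        (l.map fun i => |(l.idxOf i : ℝ) - l.countP (· < i)|).sum + l.countP (· < a) := by
      have hc : (l.countP (· < a) : ℝ) = (l.map fun i => if i < a then (1 : ℝ) else 0).sum := by
        clear ih hl ha
        induction l with
        | nil => simp
        | cons b l ih =>
          simp only [List.countP_cons, List.map_cons, List.sum_cons, ← ih]
          by_cases hb : b < a <;> simp [hb, add_comm]
      rw [hc, ← List.sum_map_add]
      refine List.sum_le_sum fun i hi => ?_
      have hia : a ≠ i := fun h => ha (h ▸ hi)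
      rw [List.idxOf_cons_ne _ hia, List.countP_cons]
      rcases lt_or_gt_of_ne hia with h | h
      · simp [h, h.not_gt]
      · simp only [h.not_gt, h, decide_false, if_true, Bool.false_eq_true, if_false]
        push_cast
        refine le_trans (le_of_eq (congrArg abs ?_))
          ((abs_add_le ((l.idxOf i : ℝ) - l.countP (· < i)) 1).trans_eq (by simp))
        ring
    simp only [List.map_cons, List.sum_cons, inversions]
    rw [List.idxOf_cons_self, List.countP_cons]
    simp only [lt_self_iff_false, decide_false, Bool.false_eq_true, if_false]
    push_cast
    have : |(0 : ℝ) - ((l.countP (· < a) : ℝ) + 0)| = l.countP (· < a) := by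
      rw [zero_sub, abs_neg, add_zero, abs_of_nonneg (by positivity)]
    rw [this]
    linarith

end Inversions

/-- The total displacement of a ranking is at most twice its number of inversions. -/
lemma avgDisplacement_le {n : ℕ} (l : List (Fin n)) (hl : l.Perm (List.finRange n)) :
    avgDisplacement l ≤ 2 * inversions l / n := by
  have h := sum_abs_idxOf_sub_countP_le l (hl.nodup_iff.2 (List.nodup_finRange n))
  rw [(hl.map _).sum_eq, ← List.ofFn_eq_map, List.sum_ofFn] at h
  rw [avgDisplacement, one_div, div_eq_inv_mul]
  refine mul_le_mul_of_nonneg_left (le_trans (le_of_eq ?_) h) (by positivity)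
  refine Finset.sum_congr rfl fun i _ => ?_
  have hc : l.countP (· < i) = i := by
    rw [hl.countP_eq, List.countP_eq_length_filter,
      ← List.toFinset_card_of_nodup ((List.nodup_finRange n).filter _)]
    have : ((List.finRange n).filter (· < i)).toFinset = Finset.Iio i := by
      ext; simp
    rw [this, Fin.card_Iio]
  rw [hc, rank]
  push_cast
  congr 1
  ring

/-! ### Inversions created by a pivot -/

section Step

variable {n : ℕ}

lemma countP_eq_card_filter {l : List (Fin n)} (hl : l.Nodup) (P : Fin n → Prop)
    [DecidablePred P] : l.countP (fun i => P i) = (l.toFinset.filter P).card := by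
  rw [List.countP_eq_length_filter, ← List.toFinset_card_of_nodup (hl.filter _),
    List.toFinset_filter]
  simp

/-- The inversions created by a pivot `p`, where `A` is the set of items put before `p` and `B` is
the set of items put after it. In an inverted pair, at least one item is on the wrong side of `p`
(or one item is `p` itself and the other one is on the wrong side). If only one is, then the other
lies between it and `p`; if both are, then the pair is counted by the product. -/
lemma card_crossInversions_le (p : Fin n) (A B : Finset (Fin n)) (hA : p ∉ A) (hB : p ∉ B) :
    (B.filter (· < p)).card + ∑ j ∈ A, ((B.filter (· < j)).card + if p < j then 1 else 0) ≤
      ∑ i ∈ B, ((p : ℕ) - i) + ∑ j ∈ A, ((j : ℕ) - p) +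
        (B.filter (· < p)).card * (A.filter (p < ·)).card := by
  have h1 : ∀ j ∈ A, (B.filter (· < j)).card + (if p < j then 1 else 0) ≤
      ((j : ℕ) - p) + (if p < j then (B.filter (· < p)).card else 0) +
        ∑ i ∈ B, (if i < j ∧ j < p then 1 else 0) := by
    intro j hj
    have hjp : j ≠ p := fun h => hA (h ▸ hj)
    rcases lt_or_gt_of_ne hjp with h | h
    · simp [h, h.not_gt]
    · simp only [h, if_true, h.not_gt, and_false, if_false, Finset.sum_const_zero, add_zero]
      have : B.filter (· < j) ⊆ B.filter (· < p) ∪ Finset.Ioo p j := by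
        intro i hi
        simp only [Finset.mem_filter, Finset.mem_union, Finset.mem_Ioo] at hi ⊢
        have : i ≠ p := fun h => hB (h ▸ hi.1)
        rcases lt_or_gt_of_ne this with h' | h'
        · exact Or.inl ⟨hi.1, h'⟩
        · exact Or.inr ⟨h', hi.2⟩
      have := (Finset.card_le_card this).trans (Finset.card_union_le _ _)
      rw [Fin.card_Ioo] at this
      have : (p : ℕ) < j := h
      omega
  have h2 : ∀ i ∈ B, (if i < p then 1 else 0) + ∑ j ∈ A, (if i < j ∧ j < p then 1 else 0) ≤
      ((p : ℕ) - i) := by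
    intro i _
    by_cases h : i < p
    · rw [if_pos h, Finset.sum_boole, Nat.cast_id]
      have : A.filter (fun j => i < j ∧ j < p) ⊆ Finset.Ioo i p := by
        intro j hj
        simpa using (Finset.mem_filter.1 hj).2
      have := Finset.card_le_card this
      rw [Fin.card_Ioo] at this
      have : (i : ℕ) < p := h
      omega
    · rw [if_neg h, Finset.sum_eq_zero]
      · simp
      · intro j _
        rw [if_neg]
        exact fun hj => h (hj.1.trans hj.2)
  have h3 := Finset.sum_le_sum h1
  have h4 := Finset.sum_le_sum h2
  simp only [Finset.sum_add_distrib] at h3 h4 ⊢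
  rw [Finset.sum_comm (s := A) (t := B), ← Finset.sum_filter (p < ·) (fun _ => (B.filter _).card),
    Finset.sum_const, smul_eq_mul] at h3
  rw [Finset.sum_boole, Nat.cast_id] at h4
  rw [mul_comm (B.filter (· < p)).card]
  omega

variable {p : Fin n} {L R : List (Fin n)}

lemma crossInversions_le (h : (p :: (L ++ R)).Nodup) :
    crossInversions p L R ≤ (R.map fun i : Fin n => (p : ℕ) - i).sum +
      (L.map fun j : Fin n => (j : ℕ) - p).sum +
      (R.map fun i : Fin n => if i < p then 1 else 0).sum *
        (L.map fun j : Fin n => if p < j then 1 else 0).sum := by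
  obtain ⟨hp, hLR⟩ := List.nodup_cons.1 h
  have hL := hLR.of_append_left
  have hR := hLR.of_append_right
  have := card_crossInversions_le p L.toFinset R.toFinset (by simp_all) (by simp_all)
  rw [crossInversions, ← List.sum_toFinset _ hL, ← List.sum_toFinset _ hL, ← List.sum_toFinset _ hL,
    ← List.sum_toFinset _ hR, ← List.sum_toFinset _ hR, Finset.sum_boole, Finset.sum_boole,
    Nat.cast_id, Nat.cast_id, countP_eq_card_filter hR]
  refine le_trans (le_of_eq ?_) this
  congr 1
  refine Finset.sum_congr rfl fun j _ => ?_
  rw [List.countP_cons, countP_eq_card_filter hR]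
  simp

/-- If all items on the wrong side of the pivot are less than `K` ranks away from it, then the pivot
creates at most `3 K ^ 2` inversions. -/
lemma crossInversions_le_of_near (h : (p :: (L ++ R)).Nodup) {K : ℕ}
    (hR' : ∀ i ∈ R, (p : ℕ) - i < K) (hL' : ∀ j ∈ L, (j : ℕ) - p < K) :
    crossInversions p L R ≤ 3 * K ^ 2 := by
  have h0 := crossInversions_le h
  obtain ⟨hp, hLR⟩ := List.nodup_cons.1 h
  have hL := hLR.of_append_left
  have hR := hLR.of_append_right
  rw [← List.sum_toFinset _ hL, ← List.sum_toFinset _ hL,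
    ← List.sum_toFinset _ hR, ← List.sum_toFinset _ hR, Finset.sum_boole, Finset.sum_boole,
    Nat.cast_id, Nat.cast_id] at h0
  have cR : (R.toFinset.filter (· < p)).card ≤ K := by
    rw [← Finset.card_range K]
    refine Finset.card_le_card_of_injOn (fun i => (p : ℕ) - i) ?_ ?_
    · intro i hi
      simp only [Finset.coe_filter, List.mem_toFinset, Set.mem_ofPred_eq] at hi
      simpa using hR' i hi.1
    · intro i hi j hj hij
      simp only [Finset.coe_filter, List.mem_toFinset, Set.mem_ofPred_eq, Fin.lt_def] at hi hj hij
      ext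
      omega
  have cL : (L.toFinset.filter (p < ·)).card ≤ K := by
    rw [← Finset.card_range K]
    refine Finset.card_le_card_of_injOn (fun i => (i : ℕ) - p) ?_ ?_
    · intro i hi
      simp only [Finset.coe_filter, List.mem_toFinset, Set.mem_ofPred_eq] at hi
      simpa using hL' i hi.1
    · intro i hi j hj hij
      simp only [Finset.coe_filter, List.mem_toFinset, Set.mem_ofPred_eq, Fin.lt_def] at hi hj hij
      ext
      omega
  have sR : ∑ i ∈ R.toFinset, ((p : ℕ) - i) ≤ K * K := by
    rw [← Finset.sum_filter_add_sum_filter_not _ (· < p)]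
    have z : ∑ i ∈ R.toFinset.filter (¬ · < p), ((p : ℕ) - i) = 0 := by
      refine Finset.sum_eq_zero fun i hi => ?_
      have := (Finset.mem_filter.1 hi).2
      simp only [Fin.lt_def] at this
      omega
    rw [z, add_zero]
    refine (Finset.sum_le_card_nsmul _ _ K fun i hi => ?_).trans ?_
    · exact (hR' i (by simpa using (Finset.mem_filter.1 hi).1)).le
    · exact Nat.mul_le_mul_right K cR
  have sL : ∑ i ∈ L.toFinset, ((i : ℕ) - p) ≤ K * K := by
    rw [← Finset.sum_filter_add_sum_filter_not _ (p < ·)]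
    have z : ∑ i ∈ L.toFinset.filter (¬ p < ·), ((i : ℕ) - p) = 0 := by
      refine Finset.sum_eq_zero fun i hi => ?_
      have := (Finset.mem_filter.1 hi).2
      simp only [Fin.lt_def] at this
      omega
    rw [z, add_zero]
    refine (Finset.sum_le_card_nsmul _ _ K fun i hi => ?_).trans ?_
    · exact (hL' i (by simpa using (Finset.mem_filter.1 hi).1)).le
    · exact Nat.mul_le_mul_right K cL
  have := Nat.mul_le_mul cR cL
  nlinarith

lemma exp_le_one_add_two_mul {x : ℝ} (h0 : 0 ≤ x) (h1 : x ≤ 1) : Real.exp x ≤ 1 + 2 * x := by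
  have := Real.abs_exp_sub_one_le (x := x) (by rwa [abs_of_nonneg h0])
  rw [abs_of_nonneg h0] at this
  linarith [le_abs_self (Real.exp x - 1)]

/-- The factor that a pivot contributes to the capped exponential moment: it is at most linear in
the number of inversions, up to an error of size `A` if there is an item on the wrong side of the
pivot and at least `K` ranks away from it. -/
lemma stepFactor_le (h : (p :: (L ++ R)).Nodup) {K : ℕ} {s A : ℝ} (hs : 0 ≤ s)
    (hK : 3 * (K : ℝ) ^ 2 * s ≤ 1) :
    ENNReal.ofReal (min A (Real.exp (s * crossInversions p L R))) ≤
      1 + ENNReal.ofReal (2 * s) *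
        ((R.map fun i : Fin n => (((p : ℕ) - i : ℕ) : ℝ≥0∞)).sum +
          (L.map fun j : Fin n => (((j : ℕ) - p : ℕ) : ℝ≥0∞)).sum +
          (R.map fun i : Fin n => ((if i < p then 1 else 0 : ℕ) : ℝ≥0∞)).sum *
            (L.map fun j : Fin n => ((if p < j then 1 else 0 : ℕ) : ℝ≥0∞)).sum) +
        ENNReal.ofReal A *
          ((R.map fun i : Fin n => ((if K ≤ (p : ℕ) - i then 1 else 0 : ℕ) : ℝ≥0∞)).sum +
            (L.map fun j : Fin n => ((if K ≤ (j : ℕ) - p then 1 else 0 : ℕ) : ℝ≥0∞)).sum) := by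
  have cast_sum : ∀ (l : List (Fin n)) (f : Fin n → ℕ),
      (l.map fun i => (f i : ℝ≥0∞)).sum = ((l.map f).sum : ℕ) := by
    intro l f
    induction l with
    | nil => simp
    | cons i l ih => simp [ih]
  simp only [cast_sum]
  by_cases hnear : (∀ i ∈ R, (p : ℕ) - i < K) ∧ (∀ j ∈ L, (j : ℕ) - p < K)
  · have h3 : (crossInversions p L R : ℝ) ≤ 3 * (K : ℝ) ^ 2 := by
      exact_mod_cast crossInversions_le_of_near h hnear.1 hnear.2
    have hs1 : s * crossInversions p L R ≤ 1 := by
      refine (mul_le_mul_of_nonneg_left h3 hs).trans ?_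
      linarith
    calc ENNReal.ofReal (min A (Real.exp (s * crossInversions p L R)))
        ≤ ENNReal.ofReal (1 + 2 * s * crossInversions p L R) := by
          refine ENNReal.ofReal_le_ofReal ((min_le_right _ _).trans ?_)
          rw [mul_assoc]
          exact exp_le_one_add_two_mul (by positivity) hs1
      _ = 1 + ENNReal.ofReal (2 * s) * (crossInversions p L R : ℕ) := by
          rw [ENNReal.ofReal_add (by norm_num) (by positivity), ENNReal.ofReal_mul (by positivity),
            ENNReal.ofReal_natCast, ENNReal.ofReal_one]
      _ ≤ _ := by
          refine le_trans ?_ le_self_add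
          gcongr
          exact_mod_cast crossInversions_le h
  · have hfar : 1 ≤ (R.map fun i : Fin n => if K ≤ (p : ℕ) - i then 1 else 0).sum +
        (L.map fun j : Fin n => if K ≤ (j : ℕ) - p then 1 else 0).sum := by
      rw [not_and_or] at hnear
      push Not at hnear
      rcases hnear with ⟨i, hi, hiK⟩ | ⟨j, hj, hjK⟩
      · have := List.single_le_sum (l := R.map fun i : Fin n => if K ≤ (p : ℕ) - i then 1 else 0)
          (by simp) _ (List.mem_map_of_mem hi)
        simp only [hiK, if_true] at this
        omega
      · have := List.single_le_sum (l := L.map fun j : Fin n => if K ≤ (j : ℕ) - p then 1 else 0)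
          (by simp) _ (List.mem_map_of_mem hj)
        simp only [hjK, if_true] at this
        omega
    refine le_trans ?_ le_add_self
    refine (ENNReal.ofReal_le_ofReal (min_le_left _ _)).trans ?_
    refine le_mul_of_one_le_right' ?_
    exact_mod_cast hfar

end Step

section Quenched

variable {n : ℕ}

/-- A bound for the mean number of inversions created by the pivot `p`, given the parameters. An
item `i < p` loses its comparison with `p` with probability at most `exp (θ p - θ i)`, an item
`j > p` wins it with probability at most `exp (θ j - θ p)`. The weights `p - i` and `j - p` are
truncated at zero. -/
noncomputable def pivotCost (θ : Fin n → ℝ) (p : Fin n) : ℝ :=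
  ∑ i : Fin n, Real.exp (θ p - θ i) * ((p : ℕ) - i : ℕ) +
    ∑ j : Fin n, Real.exp (θ j - θ p) * ((j : ℕ) - p : ℕ) +
    (∑ i : Fin n, Real.exp (θ p - θ i) * (if i < p then 1 else 0 : ℕ)) *
      (∑ j : Fin n, Real.exp (θ j - θ p) * (if p < j then 1 else 0 : ℕ))

/-- A bound for the mean number of items that are at least `K` ranks away from the pivot `p` and
are put on its wrong side. -/
noncomputable def farCost (θ : Fin n → ℝ) (K : ℕ) (p : Fin n) : ℝ :=
  ∑ i : Fin n, Real.exp (θ p - θ i) * (if K ≤ (p : ℕ) - i then 1 else 0 : ℕ) +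
    ∑ j : Fin n, Real.exp (θ j - θ p) * (if K ≤ (j : ℕ) - p then 1 else 0 : ℕ)

lemma pivotCost_nonneg (θ : Fin n → ℝ) (p : Fin n) : 0 ≤ pivotCost θ p := by
  unfold pivotCost; positivity

lemma farCost_nonneg (θ : Fin n → ℝ) (K : ℕ) (p : Fin n) : 0 ≤ farCost θ K p := by
  unfold farCost; positivity

lemma btCompare_false_le (θ : Fin n → ℝ) (i p : Fin n) :
    btCompare θ i p false ≤ ENNReal.ofReal (Real.exp (θ p - θ i)) := by
  rw [btCompare, PMF.ofFintype_apply]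
  refine ENNReal.ofReal_le_ofReal ?_
  simp only [Bool.false_eq_true, if_false]
  rw [Real.exp_sub]
  have := Real.exp_pos (θ p)
  have := Real.exp_pos (θ i)
  gcongr
  linarith

lemma btCompare_true_le (θ : Fin n → ℝ) (j p : Fin n) :
    btCompare θ j p true ≤ ENNReal.ofReal (Real.exp (θ j - θ p)) := by
  rw [btCompare, PMF.ofFintype_apply]
  refine ENNReal.ofReal_le_ofReal ?_
  simp only [if_true]
  rw [Real.exp_sub]
  have := Real.exp_pos (θ p)
  have := Real.exp_pos (θ j)
  gcongr
  linarith

lemma sum_map_mul_le {S : List (Fin n)} (hS : S.Nodup) (q : Fin n → ℝ≥0∞) (e : Fin n → ℝ)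
    (he : ∀ i, 0 ≤ e i) (hq : ∀ i, q i ≤ ENNReal.ofReal (e i)) (a : Fin n → ℕ) :
    (S.map fun i => q i * (a i : ℝ≥0∞)).sum ≤ ENNReal.ofReal (∑ i, e i * a i) := by
  rw [← List.sum_toFinset _ hS, ENNReal.ofReal_sum_of_nonneg fun i _ => by
    have := he i; positivity]
  refine (Finset.sum_le_sum_of_subset (Finset.subset_univ _)).trans ?_
  refine Finset.sum_le_sum fun i _ => ?_
  rw [ENNReal.ofReal_mul (he i), ENNReal.ofReal_natCast]
  gcongr
  exact hq i

/-- The mean factor that the pivot `p` contributes to the capped exponential moment, whatever the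
set of items is in which it is the pivot. -/
lemma mean_stepFactor_le (θ : Fin n → ℝ) {K : ℕ} {s A : ℝ} (hs : 0 ≤ s) (hA : 1 ≤ A)
    (hK : 3 * (K : ℝ) ^ 2 * s ≤ 1) (p : Fin n) (S : List (Fin n)) (hS : (p :: S).Nodup) :
    mean (partition (btCompare θ) p S)
        (fun LR => ENNReal.ofReal (min A (Real.exp (s * crossInversions p LR.1.1 LR.1.2)))) ≤
      ENNReal.ofReal (Real.exp (2 * s * pivotCost θ p + A * farCost θ K p)) := by
  have hnd := hS.of_cons
  refine (mean_mono fun LR _ =>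
    stepFactor_le ((LR.2.cons p).nodup_iff.2 hS) hs hK).trans ?_
  simp only [mean_add, mean_const_mul, mean_const, mean_partition_fst, mean_partition_snd]
  have hF := fun a => sum_map_mul_le hnd (fun i => btCompare θ i p false) _
    (fun i => (Real.exp_pos _).le) (fun i => btCompare_false_le θ i p) a
  have hT := fun a => sum_map_mul_le hnd (fun i => btCompare θ i p true) _
    (fun i => (Real.exp_pos _).le) (fun i => btCompare_true_le θ i p) a
  have key : 1 + ENNReal.ofReal (2 * s) * ENNReal.ofReal (pivotCost θ p) +
      ENNReal.ofReal A * ENNReal.ofReal (farCost θ K p) ≤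
      ENNReal.ofReal (Real.exp (2 * s * pivotCost θ p + A * farCost θ K p)) := by
    have h1 := pivotCost_nonneg θ p
    have h2 := farCost_nonneg θ K p
    rw [← ENNReal.ofReal_mul (by positivity), ← ENNReal.ofReal_mul (by positivity),
      ← ENNReal.ofReal_one, ← ENNReal.ofReal_add (by positivity) (by positivity),
      ← ENNReal.ofReal_add (by positivity) (by positivity)]
    refine ENNReal.ofReal_le_ofReal (le_trans ?_ (Real.add_one_le_exp _))
    linarith
  refine le_trans ?_ key
  gcongr
  · rw [pivotCost, ENNReal.ofReal_add (by positivity) (by positivity),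
      ENNReal.ofReal_add (by positivity) (by positivity), ENNReal.ofReal_mul (by positivity)]
    refine add_le_add (add_le_add (hF _) (hT _)) ?_
    exact (mean_partition_mul_le _ _ _ _ _).trans (mul_le_mul' (hF _) (hT _))
  · rw [farCost, ENNReal.ofReal_add (by positivity) (by positivity)]
    exact add_le_add (hF _) (hT _)

lemma min_exp_mul_le {A : ℝ} (hA : 1 ≤ A) {x y : ℝ} (hx : 0 ≤ x) (hy : 0 ≤ y) :
    min A (Real.exp (x + y)) ≤ min A (Real.exp x) * min A (Real.exp y) := by
  have h1 := Real.one_le_exp hx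
  have h2 := Real.one_le_exp hy
  rcases le_total A (Real.exp x) with h | h
  · rw [min_eq_left h]
    exact (min_le_left _ _).trans (le_mul_of_one_le_right (by linarith) (le_min hA h2))
  · rw [min_eq_right h]
    rcases le_total A (Real.exp y) with h' | h'
    · rw [min_eq_left h']
      exact (min_le_left _ _).trans (le_mul_of_one_le_left (by linarith) h1)
    · rw [min_eq_right h', ← Real.exp_add]
      exact min_le_right _ _

/-- The displacement of the output of quicksort for fixed parameters of the items. -/
theorem quicksort_avgDisplacement (θ : Fin n → ℝ) {K : ℕ} {s T : ℝ} (hs : 0 ≤ s) (hT : 0 ≤ T)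
    (hK : 3 * (K : ℝ) ^ 2 * s ≤ 1) :
    1 - ENNReal.ofReal (Real.exp (-(s * T)) *
        Real.exp (2 * s * ∑ p, pivotCost θ p + Real.exp (s * T) * ∑ p, farCost θ K p)) ≤
      (quicksort (btCompare θ) (List.finRange n)).toOuterMeasure
        {l | avgDisplacement l ≤ 2 * T / n} := by
  set A := Real.exp (s * T) with hAdef
  have hA : 1 ≤ A := Real.one_le_exp (by positivity)
  set G : List (Fin n) → ℝ≥0∞ := fun l =>
    ENNReal.ofReal (min A (Real.exp (s * inversions l))) with hG
  have hmean : mean (quicksort (btCompare θ) (List.finRange n)) G ≤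
      ENNReal.ofReal
        (Real.exp (2 * s * ∑ p, pivotCost θ p + A * ∑ p, farCost θ K p)) := by
    refine (mean_quicksort_le (btCompare θ) G
      (fun p => ENNReal.ofReal (Real.exp (2 * s * pivotCost θ p + A * farCost θ K p)))
      (fun p L R => ENNReal.ofReal (min A (Real.exp (s * crossInversions p L R))))
      ?_ ?_ ?_ (mean_stepFactor_le θ hs hA hK) _ (List.nodup_finRange n)).trans_eq ?_
    · intro S hS
      have : inversions S = 0 := by
        match S, hS with
        | [], _ => rfl
        | [a], _ => rfl
      rw [hG]
      simp only [this]
      refine ENNReal.ofReal_le_one.2 ((min_le_right _ _).trans ?_)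
      simp
    · intro p
      have h1 := pivotCost_nonneg θ p
      have h2 := farCost_nonneg θ K p
      exact ENNReal.one_le_ofReal.2 (Real.one_le_exp (by positivity))
    · intro p l r L R hl hr
      have h0 : ∀ x, 0 ≤ min A (Real.exp x) := fun x =>
        le_min (by positivity) (Real.exp_pos x).le
      simp only [hG, inversions_append_cons p hl hr]
      rw [← ENNReal.ofReal_mul (h0 _), ← ENNReal.ofReal_mul (h0 _)]
      refine ENNReal.ofReal_le_ofReal ?_
      push_cast
      rw [mul_add, mul_add]
      refine (min_exp_mul_le hA (by positivity) (by positivity)).trans ?_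
      exact mul_le_mul_of_nonneg_left
        (min_exp_mul_le hA (by positivity) (by positivity)) (h0 _)
    · rw [← List.ofFn_eq_map, List.prod_ofFn,
        ← ENNReal.ofReal_prod_of_nonneg fun p _ => (Real.exp_pos _).le, ← Real.exp_sum,
        Finset.sum_add_distrib, Finset.mul_sum, Finset.mul_sum]
  refine le_trans ?_ (one_sub_le_toOuterMeasure _ _
    (fun l => ENNReal.ofReal (Real.exp (-(s * T))) * G l) ?_)
  · rw [mean_const_mul, ENNReal.ofReal_mul (by positivity)]
    exact tsub_le_tsub_left (mul_le_mul_right hmean _) _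
  · intro l hl hlT
    rw [Set.mem_ofPred_eq, not_le] at hlT
    have h1 := hlT.trans_le (avgDisplacement_le l (quicksort_perm _ _ _ hl))
    have h2 : T ≤ inversions l := by
      by_contra! h
      have : 2 * (inversions l : ℝ) / n ≤ 2 * T / n := by gcongr
      linarith
    have h3 : A ≤ Real.exp (s * inversions l) := Real.exp_le_exp.2 (by gcongr)
    rw [hG]
    simp only [min_eq_left h3]
    rw [← ENNReal.ofReal_mul (by positivity), hAdef, ← Real.exp_add]
    simp

end Quenched

/-! ### Sums of products of independent random factors -/

section Chain

/-- The solution of the recursion `v (k + 1) = 1 + y k * v k` with `v 0 = 1`. -/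
def chain (y : ℕ → ℝ) : ℕ → ℝ
  | 0 => 1
  | k + 1 => 1 + y k * chain y k

variable {Ω : Type*} {mΩ : MeasurableSpace Ω} {P : Measure Ω} {y : ℕ → Ω → ℝ}

/-- The events that depend on `y q` for `q < k` only. -/
@[reducible] def past (y : ℕ → Ω → ℝ) (k : ℕ) : MeasurableSpace Ω :=
  ⨆ q ∈ Set.Iio k, MeasurableSpace.comap (y q) inferInstance

lemma past_mono {j k : ℕ} (h : j ≤ k) : past y j ≤ past y k :=
  biSup_mono fun _ hq => lt_of_lt_of_le hq h

lemma measurable_past {q k : ℕ} (h : q < k) : Measurable[past y k] (y q) :=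
  Measurable.of_comap_le (le_biSup (fun q => MeasurableSpace.comap (y q) inferInstance) h)

/-- A sequence of independent random factors with values almost surely in `[0, 1]`. -/
structure IsFactorSequence (P : Measure Ω) (y : ℕ → Ω → ℝ) : Prop where
  measurable : ∀ k, Measurable (y k)
  mem_Icc : ∀ k, ∀ᵐ ω ∂P, y k ω ∈ Set.Icc (0 : ℝ) 1
  indep : ∀ k, Indep (past y k) (MeasurableSpace.comap (y k) inferInstance) P

/-- A bounded random variable that depends on `y q` for `q < k` only. -/
def BddPast (P : Measure Ω) (y : ℕ → Ω → ℝ) (k : ℕ) (F : Ω → ℝ) : Prop :=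
  Measurable[past y k] F ∧ ∃ C, ∀ᵐ ω ∂P, |F ω| ≤ C

lemma IsFactorSequence.past_le (hy : IsFactorSequence P y) (k : ℕ) : past y k ≤ mΩ :=
  iSup₂_le fun q _ => (hy.measurable q).comap_le

namespace BddPast

variable {k : ℕ} {F G : Ω → ℝ}

lemma const (c : ℝ) : BddPast P y k fun _ => c :=
  ⟨measurable_const, |c|, by simp⟩

lemma add (hF : BddPast P y k F) (hG : BddPast P y k G) : BddPast P y k fun ω => F ω + G ω := by
  obtain ⟨mF, C, hC⟩ := hF
  obtain ⟨mG, D, hD⟩ := hG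
  refine ⟨mF.add mG, C + D, ?_⟩
  filter_upwards [hC, hD] with ω h1 h2
  exact (abs_add_le _ _).trans (add_le_add h1 h2)

lemma mul (hF : BddPast P y k F) (hG : BddPast P y k G) : BddPast P y k fun ω => F ω * G ω := by
  obtain ⟨mF, C, hC⟩ := hF
  obtain ⟨mG, D, hD⟩ := hG
  refine ⟨mF.mul mG, C * D, ?_⟩
  filter_upwards [hC, hD] with ω h1 h2
  rw [abs_mul]
  exact mul_le_mul h1 h2 (abs_nonneg _) ((abs_nonneg _).trans h1)

lemma pow (hF : BddPast P y k F) (m : ℕ) : BddPast P y k fun ω => F ω ^ m := by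
  induction m with
  | zero => simpa using const 1
  | succ m ih => simpa only [pow_succ] using ih.mul hF

lemma mono (hF : BddPast P y k F) {l : ℕ} (h : k ≤ l) : BddPast P y l F :=
  ⟨hF.1.mono (past_mono h) le_rfl, hF.2⟩

lemma integrable [IsFiniteMeasure P] (hy : IsFactorSequence P y) (hF : BddPast P y k F) :
    Integrable F P := by
  obtain ⟨mF, C, hC⟩ := hF
  exact Integrable.of_bound (mF.mono (hy.past_le k) le_rfl).aestronglyMeasurable C hC

end BddPast

namespace IsFactorSequence

lemma bddPast (hy : IsFactorSequence P y) {q k : ℕ} (h : q < k) : BddPast P y k (y q) := by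
  refine ⟨measurable_past h, 1, ?_⟩
  filter_upwards [hy.mem_Icc q] with ω hω
  exact abs_le.2 ⟨by linarith [hω.1], hω.2⟩

lemma bddPast_chain (hy : IsFactorSequence P y) (k : ℕ) :
    BddPast P y k fun ω => chain (fun q => y q ω) k := by
  induction k with
  | zero => exact BddPast.const 1
  | succ k ih =>
    exact (BddPast.const 1).add ((hy.bddPast k.lt_succ_self).mul (ih.mono k.le_succ))

lemma chain_nonneg (hy : IsFactorSequence P y) :
    ∀ᵐ ω ∂P, ∀ k, 0 ≤ chain (fun q => y q ω) k := by
  filter_upwards [ae_all_iff.2 hy.mem_Icc] with ω hω k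
  induction k with
  | zero => simp [chain]
  | succ k ih =>
    have := mul_nonneg (hω k).1 ih
    simp only [chain]
    linarith

lemma integral_mul (hy : IsFactorSequence P y) {k : ℕ} {F : Ω → ℝ} (hF : BddPast P y k F)
    {φ : ℝ → ℝ} (hφ : Measurable φ) :
    ∫ ω, F ω * φ (y k ω) ∂P = (∫ ω, F ω ∂P) * ∫ ω, φ (y k ω) ∂P := by
  have h : IndepFun F (fun ω => φ (y k ω)) P := by
    rw [IndepFun_iff_Indep]
    refine indep_of_indep_of_le_left (indep_of_indep_of_le_right (hy.indep k) ?_) hF.1.comap_le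
    exact (hφ.comp (comap_measurable (y k))).comap_le
  exact h.integral_fun_mul_eq_mul_integral
    (hF.1.mono (hy.past_le k) le_rfl).aestronglyMeasurable
    (hφ.comp (hy.measurable k)).aestronglyMeasurable

lemma bddPast_prod (hy : IsFactorSequence P y) {i k : ℕ} (hik : i ≤ k) :
    BddPast P y k fun ω => ∏ q ∈ Finset.Ico i k, y q ω := by
  induction k, hik using Nat.le_induction with
  | base => simpa using BddPast.const 1
  | succ k hik ih =>
    simp only [Finset.prod_Ico_succ_top hik]
    exact (ih.mono k.le_succ).mul (hy.bddPast k.lt_succ_self)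

lemma integral_prod_le [IsProbabilityMeasure P] (hy : IsFactorSequence P y) {m : ℝ} (hm0 : 0 ≤ m)
    (hm : ∀ k, ∫ ω, y k ω ∂P ≤ m) {i k : ℕ} (hik : i ≤ k) :
    ∫ ω, ∏ q ∈ Finset.Ico i k, y q ω ∂P ≤ m ^ (k - i) := by
  induction k, hik using Nat.le_induction with
  | base => simp
  | succ k hik ih =>
    simp only [Finset.prod_Ico_succ_top hik]
    rw [hy.integral_mul (φ := fun x => x) (hy.bddPast_prod hik) measurable_id,
      Nat.succ_sub hik, pow_succ]
    refine mul_le_mul ih (hm k) (integral_nonneg_of_ae ?_) (pow_nonneg hm0 _)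
    filter_upwards [hy.mem_Icc k] with ω hω using hω.1

end IsFactorSequence

lemma one_add_pow_le (m : ℕ) {x t : ℝ} (hx : 0 ≤ x) (ht0 : 0 < t) (ht1 : t < 1) :
    (1 + x) ^ (m + 1) ≤ t⁻¹ ^ m + (1 - t)⁻¹ ^ m * x ^ (m + 1) := by
  have h1 : 0 < 1 - t := by linarith
  have h := (convexOn_pow (m + 1)).2 (x := t⁻¹) (y := x * (1 - t)⁻¹)
    (Set.mem_Ici.2 (by positivity)) (Set.mem_Ici.2 (by positivity)) ht0.le h1.le (by ring)
  simp only [smul_eq_mul] at h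
  have e1 : t * t⁻¹ + (1 - t) * (x * (1 - t)⁻¹) = 1 + x := by field_simp
  rw [e1] at h
  refine h.trans_eq ?_
  rw [mul_pow, pow_succ t⁻¹, pow_succ (1 - t)⁻¹]
  field_simp

/-- The inequality `(1 + y v) ^ 4 ≤ t⁻³ + (1 - t)⁻³ y⁴ v⁴` turns a bound for the fourth moment of
the factors into a contraction for the fourth moment of the chain. -/
lemma IsFactorSequence.integral_chain_pow_four_le [IsProbabilityMeasure P]
    (hy : IsFactorSequence P y) {t : ℝ} (ht0 : 0 < t) (ht1 : t < 1)
    (h4 : ∀ k, ∫ ω, y k ω ^ 4 ∂P ≤ 1 - 4 * t) (k : ℕ) :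
    ∫ ω, chain (fun q => y q ω) k ^ 4 ∂P ≤ t⁻¹ ^ 4 := by
  have h1t : 0 < 1 - t := by linarith
  induction k with
  | zero =>
    simp only [chain, one_pow, integral_const, probReal_univ, smul_eq_mul, mul_one]
    exact one_le_pow₀ ((one_le_inv₀ ht0).2 ht1.le)
  | succ k ih =>
    have hV := hy.bddPast_chain k
    have hle : ∀ᵐ ω ∂P, chain (fun q => y q ω) (k + 1) ^ 4 ≤
        t⁻¹ ^ 3 + (1 - t)⁻¹ ^ 3 * (chain (fun q => y q ω) k ^ 4 * y k ω ^ 4) := by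
      filter_upwards [hy.chain_nonneg, hy.mem_Icc k] with ω h1 h2
      refine (one_add_pow_le 3 (mul_nonneg h2.1 (h1 k)) ht0 ht1).trans_eq ?_
      rw [mul_pow]
      ring
    have hint : BddPast P y (k + 1) fun ω => (chain (fun q => y q ω) k ^ 4 * y k ω ^ 4) :=
      ((hV.pow 4).mono k.le_succ).mul ((hy.bddPast k.lt_succ_self).pow 4)
    refine (integral_mono_ae (((hy.bddPast_chain (k + 1)).pow 4).integrable hy)
      ((integrable_const _).add ((hint.integrable hy).const_mul _)) hle).trans ?_
    rw [integral_add' (integrable_const _) ((hint.integrable hy).const_mul _), integral_const_mul,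
      hy.integral_mul (φ := fun x => x ^ 4) (hV.pow 4) (by fun_prop)]
    simp only [integral_const, probReal_univ, smul_eq_mul, one_mul]
    have hI0 : 0 ≤ ∫ ω, chain (fun q => y q ω) k ^ 4 ∂P :=
      integral_nonneg fun ω => by positivity
    -- Bernoulli's inequality: `1 - 4 t ≤ (1 - t) ^ 4`
    have hB : 1 - 4 * t ≤ (1 - t) ^ 4 := by nlinarith [sq_nonneg t, sq_nonneg (t ^ 2 - 2 * t)]
    calc t⁻¹ ^ 3 + (1 - t)⁻¹ ^ 3 * ((∫ ω, chain (fun q => y q ω) k ^ 4 ∂P) * ∫ ω, y k ω ^ 4 ∂P)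
        ≤ t⁻¹ ^ 3 + (1 - t)⁻¹ ^ 3 * (t⁻¹ ^ 4 * (1 - t) ^ 4) := by
          refine add_le_add le_rfl (mul_le_mul_of_nonneg_left ?_ (by positivity))
          exact (mul_le_mul_of_nonneg_left ((h4 k).trans hB) hI0).trans
            (mul_le_mul_of_nonneg_right ih (by positivity))
      _ = t⁻¹ ^ 4 := by
          field_simp
          ring

/-- The martingale part of the sum of the squares of the chain. -/
noncomputable def chainMartingale (P : Measure Ω) (y : ℕ → Ω → ℝ) (k : ℕ) (ω : Ω) : ℝ :=
  ∑ q ∈ Finset.range k, (y q ω ^ 2 - ∫ ω', y q ω' ^ 2 ∂P) * chain (fun r => y r ω) q ^ 2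

lemma IsFactorSequence.bddPast_chainMartingale (hy : IsFactorSequence P y) (k : ℕ) :
    BddPast P y k (chainMartingale P y k) := by
  unfold chainMartingale
  induction k with
  | zero => simpa using BddPast.const 0
  | succ k ih =>
    simp only [Finset.sum_range_succ, sub_eq_add_neg]
    exact (ih.mono k.le_succ).add (((((hy.bddPast k.lt_succ_self).pow 2).add
      (BddPast.const _))).mul (((hy.bddPast_chain k).pow 2).mono k.le_succ))

/-- The increments of the martingale part are orthogonal. -/
lemma IsFactorSequence.integral_chainMartingale_sq_le [IsProbabilityMeasure P]
    (hy : IsFactorSequence P y) {D : ℝ}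
    (hD : ∀ k, ∫ ω, chain (fun q => y q ω) k ^ 4 ∂P ≤ D) (k : ℕ) :
    ∫ ω, chainMartingale P y k ω ^ 2 ∂P ≤ k * D := by
  induction k with
  | zero => simp [chainMartingale]
  | succ k ih =>
    set m := ∫ ω, y k ω ^ 2 ∂P with hm
    have hV := hy.bddPast_chain k
    have hM := hy.bddPast_chainMartingale k
    have hm0 : 0 ≤ m := integral_nonneg fun ω => by positivity
    have hyk := hy.bddPast k.lt_succ_self
    have hm1 : m ≤ 1 := by
      have : ∫ ω, y k ω ^ 2 ∂P ≤ ∫ _, (1 : ℝ) ∂P := by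
        refine integral_mono_ae ((hyk.pow 2).integrable hy) (integrable_const _) ?_
        filter_upwards [hy.mem_Icc k] with ω hω
        exact pow_le_one₀ hω.1 hω.2
      simpa using this
    have hle : ∀ᵐ ω ∂P, chainMartingale P y (k + 1) ω ^ 2 ≤
        chainMartingale P y k ω ^ 2 +
          2 * ((chainMartingale P y k ω * chain (fun r => y r ω) k ^ 2) * (y k ω ^ 2 - m)) +
          chain (fun r => y r ω) k ^ 4 := by
      filter_upwards [hy.mem_Icc k] with ω hω
      have e : chainMartingale P y (k + 1) ω = chainMartingale P y k ω +
          (y k ω ^ 2 - m) * chain (fun r => y r ω) k ^ 2 := by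
        rw [chainMartingale, Finset.sum_range_succ, ← chainMartingale]
      have h1 : y k ω ^ 2 ≤ 1 := pow_le_one₀ hω.1 hω.2
      have h2 : (y k ω ^ 2 - m) ^ 2 ≤ 1 := by
        rw [sq_le_one_iff_abs_le_one, abs_le]
        constructor <;> linarith [sq_nonneg (y k ω)]
      have h3 : 0 ≤ chain (fun r => y r ω) k ^ 4 := by positivity
      rw [e]
      nlinarith
    have b1 := (hM.pow 2).mono k.le_succ
    have b2 := (hM.mul (hV.pow 2))
    have b3 := (b2.mono k.le_succ).mul ((hyk.pow 2).add (BddPast.const (-m)))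
    simp only [← sub_eq_add_neg] at b3
    have i3 := (b3.integrable hy).const_mul 2
    have i4 := (hV.pow 4).integrable hy
    refine (integral_mono_ae (((hy.bddPast_chainMartingale (k + 1)).pow 2).integrable hy)
      (((b1.integrable hy).add i3).add i4) hle).trans ?_
    have hzero : ∫ ω, (y k ω ^ 2 - m) ∂P = 0 := by
      rw [integral_sub ((hyk.pow 2).integrable hy) (integrable_const _), ← hm]
      simp
    rw [integral_add' ((b1.integrable hy).add i3) i4, integral_add' (b1.integrable hy) i3,
      integral_const_mul, hy.integral_mul (φ := fun x => x ^ 2 - m) b2 (by fun_prop), hzero]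
    have := hD k
    push_cast
    linarith

lemma IsFactorSequence.sum_chain_sq_le (hy : IsFactorSequence P y) {t : ℝ} (ht0 : 0 < t)
    (ht1 : t < 1) (h2 : ∀ k, ∫ ω, y k ω ^ 2 ∂P ≤ 1 - 2 * t) (N : ℕ) :
    ∀ᵐ ω ∂P, t * ∑ k ∈ Finset.range (N + 1), chain (fun q => y q ω) k ^ 2 ≤
      (N + 1) * t⁻¹ + (1 - t)⁻¹ * chainMartingale P y N ω := by
  have h1t : 0 < 1 - t := by linarith
  filter_upwards [hy.chain_nonneg, ae_all_iff.2 hy.mem_Icc] with ω hV hω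
  set V := chain fun q => y q ω with hVdef
  -- the last term is not multiplied by `t`, which makes the induction work
  have key : ∀ N : ℕ, t * ∑ k ∈ Finset.range N, V k ^ 2 + V N ^ 2 ≤
      1 + N * t⁻¹ + (1 - t)⁻¹ * chainMartingale P y N ω := by
    intro N
    induction N with
    | zero => simp [chainMartingale, hVdef, chain]
    | succ N ih =>
      have e : chainMartingale P y (N + 1) ω = chainMartingale P y N ω +
          (y N ω ^ 2 - ∫ ω', y N ω' ^ 2 ∂P) * V N ^ 2 := by
        rw [chainMartingale, Finset.sum_range_succ, ← chainMartingale]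
      have h := one_add_pow_le 1 (mul_nonneg (hω N).1 (hV N)) ht0 ht1
      have hs : V (N + 1) = 1 + y N ω * V N := rfl
      rw [e, Finset.sum_range_succ, hs]
      have hB : (1 - t)⁻¹ * (∫ ω', y N ω' ^ 2 ∂P) * V N ^ 2 ≤ (1 - t) * V N ^ 2 := by
        refine mul_le_mul_of_nonneg_right ?_ (by positivity)
        rw [inv_mul_le_iff₀ h1t]
        nlinarith [h2 N, sq_nonneg t]
      push_cast
      norm_num at h
      nlinarith
  have h := key N
  have ht : 1 ≤ t⁻¹ := (one_le_inv₀ ht0).2 ht1.le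
  rw [Finset.sum_range_succ]
  nlinarith [sq_nonneg (V N)]

/-- The sum of the squares of the chain is at most of order `Λ ^ 2` per step on average; it exceeds
`14 Λ ^ 3` per step with probability of the order of the reciprocal of the number of steps only,
by Chebyshev's inequality for the martingale part. -/
theorem IsFactorSequence.measure_sum_chain_sq_le [IsProbabilityMeasure P]
    (hy : IsFactorSequence P y) {Λ : ℝ} (hΛ : 1 ≤ Λ)
    (h2 : ∀ k, ∫ ω, y k ω ^ 2 ∂P ≤ 1 - 2 / (Λ + 2))
    (h4 : ∀ k, ∫ ω, y k ω ^ 4 ∂P ≤ 1 - 4 / (Λ + 4)) (N : ℕ) :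
    P.real {ω | 14 * Λ ^ 3 * (N + 1) < ∑ k ∈ Finset.range (N + 1), chain (fun q => y q ω) k ^ 2} ≤
      625 / (N + 1) := by
  have hM := hy.integral_chainMartingale_sq_le (hy.integral_chain_pow_four_le
    (t := (Λ + 4)⁻¹) (by positivity) (inv_lt_one_of_one_lt₀ (by linarith))
    (fun k => by simpa only [div_eq_mul_inv] using h4 k)) N
  rw [inv_inv] at hM
  have hS := hy.sum_chain_sq_le (t := (Λ + 2)⁻¹) (by positivity)
    (inv_lt_one_of_one_lt₀ (by linarith)) (fun k => by simpa only [div_eq_mul_inv] using h2 k) N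
  set M := chainMartingale P y N
  have hsub : P.real {ω | 14 * Λ ^ 3 * (N + 1) <
      ∑ k ∈ Finset.range (N + 1), chain (fun q => y q ω) k ^ 2} ≤
      P.real {ω | ((N + 1) * Λ ^ 2) ^ 2 ≤ M ω ^ 2} := by
    refine ENNReal.toReal_mono (measure_ne_top _ _) (measure_mono_ae ?_)
    filter_upwards [hS] with ω hω
    intro (h : 14 * Λ ^ 3 * (N + 1) < _)
    show ((N + 1) * Λ ^ 2) ^ 2 ≤ M ω ^ 2
    set s := ∑ k ∈ Finset.range (N + 1), chain (fun q => y q ω) k ^ 2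
    have hN : (0 : ℝ) ≤ N := by positivity
    have e : (1 - (Λ + 2)⁻¹)⁻¹ = (Λ + 2) / (Λ + 1) := by
      rw [← inv_div]
      congr 1
      field_simp
      ring
    rw [inv_inv, e, inv_mul_le_iff₀ (by positivity)] at hω
    have hMpos : (N + 1) * Λ ^ 2 ≤ M ω := by
      by_contra! hlt
      have h3 : (Λ + 2) / (Λ + 1) ≤ 3 / 2 := by
        rw [div_le_div_iff₀ (by positivity) (by positivity)]; linarith
      have h4 : (Λ + 2) / (Λ + 1) * M ω ≤ 3 / 2 * ((N + 1) * Λ ^ 2) :=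
        (mul_le_mul_of_nonneg_left hlt.le (by positivity)).trans
          (mul_le_mul_of_nonneg_right h3 (by positivity))
      have h5 : s ≤ (Λ + 2) * ((N + 1) * (Λ + 2) + 3 / 2 * ((N + 1) * Λ ^ 2)) :=
        hω.trans (by gcongr)
      have h6 : (Λ + 2) * ((Λ + 2) + 3 / 2 * Λ ^ 2) ≤ 14 * Λ ^ 3 := by
        nlinarith [mul_nonneg (sub_nonneg.2 hΛ) (sub_nonneg.2 hΛ), sq_nonneg Λ,
          mul_nonneg (sq_nonneg Λ) (sub_nonneg.2 hΛ)]
      have h7 := mul_le_mul_of_nonneg_left h6 (by positivity : (0 : ℝ) ≤ N + 1)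
      nlinarith
    exact pow_le_pow_left₀ (by positivity) hMpos 2
  refine hsub.trans ?_
  have hmk := mul_meas_ge_le_integral_of_nonneg (μ := P) (f := fun ω => M ω ^ 2)
    (Filter.Eventually.of_forall fun ω => sq_nonneg _)
    (((hy.bddPast_chainMartingale N).pow 2).integrable hy) ((((N : ℝ) + 1) * Λ ^ 2) ^ 2)
  have hlast : (N : ℝ) * (Λ + 4) ^ 4 ≤ (((N : ℝ) + 1) * Λ ^ 2) ^ 2 * (625 / (N + 1)) := by
    have h5 : (Λ + 4) ^ 4 ≤ (5 * Λ) ^ 4 := pow_le_pow_left₀ (by positivity) (by linarith) 4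
    calc (N : ℝ) * (Λ + 4) ^ 4 ≤ (N + 1) * (5 * Λ) ^ 4 := by gcongr; linarith
      _ = _ := by field_simp; ring
  exact le_of_mul_le_mul_left ((hmk.trans hM).trans hlast) (by positivity)

end Chain

/-! ### Exponential gaps and sums over the items -/

section Exponential

lemma integral_exp_neg_mul_expMeasure {r a : ℝ} (hr : 0 < r) (ha : 0 ≤ a) :
    ∫ x, Real.exp (-(a * x)) ∂(expMeasure r) = r / (r + a) := by
  have hra : 0 < r + a := by linarith
  rw [integral_eq_lintegral_of_nonneg_ae (Filter.Eventually.of_forall fun x => (Real.exp_pos _).le)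
    (by fun_prop)]
  have hdens : expMeasure r = volume.withDensity (exponentialPDF r) := rfl
  have hmeas : ∀ b, Measurable (exponentialPDF b) := fun b =>
    (measurable_exponentialPDFReal b).ennreal_ofReal
  rw [hdens, lintegral_withDensity_eq_lintegral_mul _ (hmeas r) (by fun_prop)]
  have h : ∀ x, (exponentialPDF r * fun x => ENNReal.ofReal (Real.exp (-(a * x)))) x =
      ENNReal.ofReal (r / (r + a)) * exponentialPDF (r + a) x := by
    intro x
    rw [Pi.mul_apply]
    rcases lt_or_ge x 0 with hx | hx
    · simp [exponentialPDF_of_neg hx]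
    · rw [exponentialPDF_of_nonneg hx, exponentialPDF_of_nonneg hx,
        ← ENNReal.ofReal_mul (by positivity), ← ENNReal.ofReal_mul (by positivity), mul_assoc,
        ← Real.exp_add]
      congr 1
      rw [← mul_assoc, div_mul_cancel₀ _ hra.ne']
      congr 2
      ring
  rw [lintegral_congr h, lintegral_const_mul _ (hmeas _), lintegral_exponentialPDF_eq_one hra,
    mul_one, ENNReal.toReal_ofReal (by positivity)]

lemma ae_nonneg_expMeasure (r : ℝ) : ∀ᵐ x ∂(expMeasure r), 0 ≤ x := by
  have hdens : expMeasure r = volume.withDensity (exponentialPDF r) := rfl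
  have : {x : ℝ | ¬ 0 ≤ x} = Set.Iio 0 := by ext; simp
  rw [ae_iff, this, hdens, withDensity_apply _ measurableSet_Iio,
    lintegral_exponentialPDF_of_nonpos le_rfl]

end Exponential

section Factors

/-- The factors `exp (-x k)`, continued by zero. -/
noncomputable def factor {m : ℕ} (x : Fin m → ℝ) (k : ℕ) : ℝ :=
  if h : k < m then Real.exp (-x ⟨k, h⟩) else 0

variable {Ω : Type*} {mΩ : MeasurableSpace Ω} {P : Measure Ω} {m : ℕ}
  {X : Ω → Fin m → ℝ}

lemma isFactorSequence_factor [IsProbabilityMeasure P] (hX : ∀ i, Measurable fun ω => X ω i)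
    (hind : iIndepFun (fun i ω => X ω i) P) {rate : ℝ}
    (hlaw : ∀ i, HasLaw (fun ω => X ω i) (expMeasure rate) P) :
    IsFactorSequence P fun k ω => factor (X ω) k := by
  have hmeas : ∀ k, Measurable fun ω => factor (X ω) k := by
    intro k
    unfold factor
    split_ifs with h
    · exact (hX _).neg.exp
    · exact measurable_const
  refine ⟨hmeas, fun k => ?_, fun k => ?_⟩
  · unfold factor
    split_ifs with h
    · have h0 : ∀ᵐ ω ∂P, 0 ≤ X ω ⟨k, h⟩ := by
        have := ae_nonneg_expMeasure rate
        rw [← (hlaw ⟨k, h⟩).map_eq] at this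
        exact ae_of_ae_map (hlaw ⟨k, h⟩).aemeasurable this
      filter_upwards [h0] with ω hω
      exact ⟨(Real.exp_pos _).le, Real.exp_le_one_iff.2 (by linarith)⟩
    · simp
  · by_cases h : k < m
    · have hsup := indep_iSup_of_disjoint (μ := P) (m := fun i : Fin m =>
        MeasurableSpace.comap (fun ω => X ω i) inferInstance) (fun i => (hX i).comap_le) hind
        (S := {i : Fin m | (i : ℕ) < k}) (T := {⟨k, h⟩})
        (by rw [Set.disjoint_singleton_right]; simp)
      have hle : ∀ (q : ℕ) (hq : q < m),
          MeasurableSpace.comap (fun ω => factor (X ω) q) inferInstance ≤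
            MeasurableSpace.comap (fun ω => X ω ⟨q, hq⟩) inferInstance := by
        intro q hq
        have : (fun ω => factor (X ω) q) = fun ω => Real.exp (-X ω ⟨q, hq⟩) := by
          funext ω
          rw [factor, dif_pos hq]
        rw [this]
        exact (comap_measurable fun ω => X ω ⟨q, hq⟩).neg.exp.comap_le
      refine indep_of_indep_of_le_left (indep_of_indep_of_le_right hsup ?_) ?_
      · rw [iSup_singleton]
        exact hle k h
      · refine iSup₂_le fun q hq => (hle q (lt_trans hq h)).trans ?_
        exact le_biSup (fun i : Fin m => MeasurableSpace.comap (fun ω => X ω i) inferInstance)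
          (show (⟨q, lt_trans hq h⟩ : Fin m) ∈ {i : Fin m | (i : ℕ) < k} from hq)
    · have : (fun ω => factor (X ω) k) = fun _ => (0 : ℝ) := by
        funext ω
        rw [factor, dif_neg h]
      rw [this, MeasurableSpace.comap_const]
      exact indep_bot_right _

lemma integral_factor_pow_le {rate : ℝ} (hrate : 0 < rate)
    (hlaw : ∀ i, HasLaw (fun ω => X ω i) (expMeasure rate) P) (j : ℕ) (hj : 0 < j) (k : ℕ) :
    ∫ ω, factor (X ω) k ^ j ∂P ≤ 1 - j / (max 1 rate + j) := by
  have hj' : (0 : ℝ) < j := by exact_mod_cast hj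
  have h1 : (1 : ℝ) ≤ max 1 rate := le_max_left _ _
  have h2 : rate ≤ max 1 rate := le_max_right _ _
  have e : 1 - j / (max 1 rate + j) = max 1 rate / (max 1 rate + j) := by
    field_simp; ring
  rw [e]
  unfold factor
  split_ifs with h
  · have : ∀ ω, Real.exp (-X ω ⟨k, h⟩) ^ j = (fun x => Real.exp (-((j : ℝ) * x))) (X ω ⟨k, h⟩) := by
      intro ω
      simp only
      rw [← Real.exp_nat_mul]
      congr 1
      ring
    simp only [this]
    have hc := (hlaw ⟨k, h⟩).integral_comp (f := fun x => Real.exp (-((j : ℝ) * x)))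
      (by fun_prop)
    simp only [Function.comp_def] at hc
    rw [hc, integral_exp_neg_mul_expMeasure hrate hj'.le,
      div_le_div_iff₀ (by positivity) (by positivity)]
    nlinarith
  · simp only [zero_pow hj.ne', integral_zero]
    positivity

end Factors

section Sums

variable {n : ℕ}

/-- The sum of `exp (-(θ i - θ j))` over the items `i` ranked no lower than `j`. -/
noncomputable def sumAbove (θ : Fin n → ℝ) (j : Fin n) : ℝ :=
  ∑ i : Fin n, if i ≤ j then Real.exp (θ j - θ i) else 0

/-- The sum of `exp (-(θ j - θ p))` over the items `p` ranked no higher than `j`. -/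
noncomputable def sumBelow (θ : Fin n → ℝ) (j : Fin n) : ℝ :=
  ∑ p : Fin n, if j ≤ p then Real.exp (θ p - θ j) else 0

/-- The parameters with the order of the items reversed. -/
def mirror (θ : Fin n → ℝ) (i : Fin n) : ℝ := -θ i.rev

lemma sumBelow_eq_sumAbove_mirror (θ : Fin n → ℝ) (j : Fin n) :
    sumBelow θ j = sumAbove (mirror θ) j.rev := by
  rw [sumBelow, sumAbove, ← Equiv.sum_comp Fin.revPerm]
  refine Finset.sum_congr rfl fun i _ => ?_
  simp only [Fin.revPerm_apply, mirror, Fin.rev_rev]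
  have : j ≤ i.rev ↔ i ≤ j.rev := by rw [← Fin.rev_le_rev, Fin.rev_rev]
  simp only [this]
  congr 2
  ring

lemma gap_mirror (θ : Fin n → ℝ) (i : Fin (n - 1)) : gap (mirror θ) i = gap θ i.rev := by
  have hi := i.2
  have e1 : (⟨i, by omega⟩ : Fin n).rev = ⟨i.rev + 1, by rw [Fin.val_rev]; omega⟩ := by
    ext; simp only [Fin.val_rev]; omega
  have e2 : (⟨i + 1, by omega⟩ : Fin n).rev = ⟨i.rev, by rw [Fin.val_rev]; omega⟩ := by
    ext; simp only [Fin.val_rev]; omega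
  rw [gap, gap, mirror, mirror, e1, e2]
  ring

lemma exp_sub_eq_prod_factor (θ : Fin n → ℝ) {i p : Fin n} (h : i ≤ p) :
    Real.exp (θ p - θ i) = ∏ q ∈ Finset.Ico (i : ℕ) p, factor (gap θ) q := by
  obtain ⟨p, hp⟩ := p
  simp only
  have h' : (i : ℕ) ≤ p := h
  clear h
  induction p, h' using Nat.le_induction with
  | base => simp
  | succ p hip ih =>
    rw [Finset.prod_Ico_succ_top hip, ← ih (by omega), factor, dif_pos (by omega), ← Real.exp_add,
      gap]
    congr 1
    ring

lemma sumAbove_eq_chain (θ : Fin n → ℝ) (j : Fin n) :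
    sumAbove θ j = chain (factor (gap θ)) j := by
  have key : ∀ k (hk : k < n),
      ∑ i ∈ Finset.range (k + 1), ∏ q ∈ Finset.Ico i k, factor (gap θ) q =
        chain (factor (gap θ)) k := by
    intro k hk
    induction k with
    | zero => simp [chain]
    | succ k ih =>
      rw [Finset.sum_range_succ, chain, ← ih (by omega), Finset.mul_sum, add_comm]
      simp only [Finset.Ico_self, Finset.prod_empty]
      congr 1
      refine Finset.sum_congr rfl fun i hi => ?_
      rw [Finset.prod_Ico_succ_top (Nat.lt_succ_iff.1 (Finset.mem_range.1 hi)), mul_comm]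
  rw [← key j j.2, sumAbove, ← Finset.sum_filter]
  refine Finset.sum_bij (fun i _ => (i : ℕ)) ?_ ?_ ?_ ?_
  · intro i hi
    simp only [Finset.mem_filter, Finset.mem_univ, true_and, Fin.le_def] at hi
    simp; omega
  · intro a _ b _ h
    exact Fin.ext h
  · intro b hb
    simp only [Finset.mem_range] at hb
    have hbj : (⟨b, by omega⟩ : Fin n) ≤ j := Fin.le_def.2 (Nat.lt_succ_iff.1 hb)
    exact ⟨_, Finset.mem_filter.2 ⟨Finset.mem_univ _, hbj⟩, rfl⟩
  · intro i hi
    exact exp_sub_eq_prod_factor θ (Finset.mem_filter.1 hi).2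

lemma sum_sumAbove_sq (θ : Fin n → ℝ) :
    ∑ j, sumAbove θ j ^ 2 = ∑ k ∈ Finset.range n, chain (factor (gap θ)) k ^ 2 := by
  rw [← Fin.sum_univ_eq_sum_range (fun k => chain (factor (gap θ)) k ^ 2)]
  simp only [sumAbove_eq_chain]

lemma sum_sumBelow_sq (θ : Fin n → ℝ) :
    ∑ j, sumBelow θ j ^ 2 = ∑ j, sumAbove (mirror θ) j ^ 2 := by
  rw [← Equiv.sum_comp Fin.revPerm]
  simp only [sumBelow_eq_sumAbove_mirror, Fin.revPerm_apply, Fin.rev_rev]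

/-- All three parts of the cost of the pivots are sums over triples `i ≤ j ≤ p` of
`exp (-(θ i - θ j)) * exp (-(θ j - θ p))`: in the first two parts, the factor `p - i` counts the
items `j` between `i` and `p`; in the third one, `j` is the pivot. -/
lemma sum_pivotCost_le (θ : Fin n → ℝ) :
    ∑ p, pivotCost θ p ≤ 3 * ∑ j, sumAbove θ j * sumBelow θ j := by
  have h1 : ∑ p, ∑ i, Real.exp (θ p - θ i) * ((p : ℕ) - i : ℕ) ≤
      ∑ j, sumAbove θ j * sumBelow θ j := by
    have e : ∑ j, sumAbove θ j * sumBelow θ j = ∑ p, ∑ i, ∑ j,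
        (if i ≤ j then Real.exp (θ j - θ i) else 0) *
          (if j ≤ p then Real.exp (θ p - θ j) else 0) := by
      simp only [sumAbove, sumBelow, Finset.sum_mul_sum]
      rw [Finset.sum_comm]
      conv_rhs => rw [Finset.sum_comm]
      exact Finset.sum_congr rfl fun i _ => Finset.sum_comm
    rw [e]
    refine Finset.sum_le_sum fun p _ => Finset.sum_le_sum fun i _ => ?_
    have hc : ((p : ℕ) - i : ℕ) = (Finset.Ioc i p).card := by rw [Fin.card_Ioc]
    rw [hc, mul_comm, ← nsmul_eq_mul, ← Finset.sum_const]
    refine (Finset.sum_le_sum fun j hj => ?_).trans (Finset.sum_le_sum_of_subset_of_nonneg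
      (Finset.subset_univ (Finset.Ioc i p)) fun j _ _ => ?_)
    · obtain ⟨hij, hjp⟩ := Finset.mem_Ioc.1 hj
      rw [if_pos hij.le, if_pos hjp, ← Real.exp_add]
      refine (congrArg Real.exp ?_).le
      ring
    · split_ifs <;> positivity
  have h2 : ∑ p, (∑ i, Real.exp (θ p - θ i) * (if i < p then 1 else 0 : ℕ)) *
      (∑ j, Real.exp (θ j - θ p) * (if p < j then 1 else 0 : ℕ)) ≤
      ∑ j, sumAbove θ j * sumBelow θ j := by
    refine Finset.sum_le_sum fun p _ => mul_le_mul ?_ ?_ (by positivity) ?_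
    · refine Finset.sum_le_sum fun i _ => ?_
      by_cases h : i < p
      · simp [h, h.le]
      · simp only [h, if_false, Nat.cast_zero, mul_zero]
        split_ifs <;> positivity
    · refine Finset.sum_le_sum fun i _ => ?_
      by_cases h : p < i
      · simp [h, h.le]
      · simp only [h, if_false, Nat.cast_zero, mul_zero]
        split_ifs <;> positivity
    · refine Finset.sum_nonneg fun i _ => ?_
      split_ifs <;> positivity
  simp only [pivotCost, Finset.sum_add_distrib]
  rw [Finset.sum_comm (f := fun p j => Real.exp (θ j - θ p) * ((j : ℕ) - p : ℕ))]
  linarith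

lemma sum_pivotCost_le_sq (θ : Fin n → ℝ) :
    ∑ p, pivotCost θ p ≤ 3 / 2 * (∑ j, sumAbove θ j ^ 2 + ∑ j, sumBelow θ j ^ 2) := by
  refine (sum_pivotCost_le θ).trans ?_
  rw [← Finset.sum_add_distrib, Finset.mul_sum, Finset.mul_sum]
  refine Finset.sum_le_sum fun j _ => ?_
  nlinarith [sq_nonneg (sumAbove θ j - sumBelow θ j)]

lemma sum_farCost_eq (θ : Fin n → ℝ) (K : ℕ) :
    ∑ p, farCost θ K p = 2 * ∑ p : Fin n, ∑ i : Fin n,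
      if K ≤ (p : ℕ) - i then Real.exp (θ p - θ i) else 0 := by
  simp only [farCost, Finset.sum_add_distrib]
  rw [Finset.sum_comm (f := fun p j : Fin n =>
    Real.exp (θ j - θ p) * (if K ≤ (j : ℕ) - p then 1 else 0 : ℕ)), ← two_mul]
  simp

end Sums

/-! ### Displacement for random parameters -/

section Good

variable {n : ℕ}

/-- The parameters for which quicksort makes few errors: the inversions have a small mean, and
errors between distant items are unlikely. -/
def goodParameters (n : ℕ) (Λ : ℝ) (K : ℕ) : Set (Fin n → ℝ) :=
  {θ | ∑ j, sumAbove θ j ^ 2 ≤ 14 * Λ ^ 3 * n} ∩ {θ | ∑ j, sumBelow θ j ^ 2 ≤ 14 * Λ ^ 3 * n} ∩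
    {θ | ∑ p, farCost θ K p ≤ 1 / n}

lemma measurableSet_goodParameters (Λ : ℝ) (K : ℕ) :
    MeasurableSet (goodParameters n Λ K) := by
  have h1 : ∀ j, Measurable fun θ : Fin n → ℝ => sumAbove θ j := by
    intro j
    unfold sumAbove
    refine Finset.measurable_sum _ fun i _ => ?_
    split_ifs <;> fun_prop
  have h2 : ∀ j, Measurable fun θ : Fin n → ℝ => sumBelow θ j := by
    intro j
    unfold sumBelow
    refine Finset.measurable_sum _ fun i _ => ?_
    split_ifs <;> fun_prop
  have h3 : ∀ p, Measurable fun θ : Fin n → ℝ => farCost θ K p := by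
    intro p
    unfold farCost
    fun_prop
  refine ((measurableSet_le ?_ measurable_const).inter
    (measurableSet_le ?_ measurable_const)).inter (measurableSet_le ?_ measurable_const)
  · exact Finset.measurable_sum _ fun j _ => (h1 j).pow_const 2
  · exact Finset.measurable_sum _ fun j _ => (h2 j).pow_const 2
  · exact Finset.measurable_sum _ fun j _ => h3 j

lemma log_le_two_mul_sq {n : ℕ} {x : ℝ} (hx : 0 < x) (hxn : x ^ 4 = n) :
    Real.log n ≤ 2 * x ^ 2 := by
  have : (n : ℝ) = (x ^ 2) ^ 2 := by rw [← hxn]; ring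
  rw [this, Real.log_pow]
  have := Real.log_le_self (x := x ^ 2) (by positivity)
  push_cast
  linarith

/-- For good parameters, the capped exponential moment is applied with the cap `n`, which is
reached at `168 Λ ^ 3 n` inversions. -/
lemma quicksort_of_goodParameters (hn : 1 ≤ n) {Λ x : ℝ} (hΛ : 1 ≤ Λ) (hx : 0 < x)
    (hxn : x ^ 4 = n) {θ : Fin n → ℝ} (hθ : θ ∈ goodParameters n Λ ⌈Λ * x⌉₊) :
    1 - ENNReal.ofReal (Real.exp 1 / x ^ 2) ≤
      (quicksort (btCompare θ) (List.finRange n)).toOuterMeasure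
        {l | avgDisplacement l ≤ 336 * Λ ^ 3} := by
  obtain ⟨⟨h1, h2⟩, h3⟩ := hθ
  simp only [Set.mem_ofPred_eq] at h1 h2 h3
  have hn' : (1 : ℝ) ≤ n := by exact_mod_cast hn
  have hn0 : (0 : ℝ) < n := by linarith
  have hlog0 : 0 ≤ Real.log n := Real.log_nonneg hn'
  have hlog := log_le_two_mul_sq hx hxn
  have hx1 : 1 ≤ x := by
    by_contra! h
    have := pow_lt_one₀ hx.le h (n := 4) (by norm_num)
    linarith
  set K := ⌈Λ * x⌉₊
  set T := 168 * Λ ^ 3 * n with hT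
  have hT0 : 0 < T := by positivity
  set s := Real.log n / T with hs
  have hs0 : 0 ≤ s := by positivity
  have hsT : s * T = Real.log n := div_mul_cancel₀ _ hT0.ne'
  have hK : (K : ℝ) ≤ 2 * (Λ * x) := by
    have := (Nat.ceil_lt_add_one (by positivity : 0 ≤ Λ * x)).le
    nlinarith
  have hK' : 3 * (K : ℝ) ^ 2 * s ≤ 1 := by
    rw [hs, mul_div_assoc', div_le_one hT0]
    calc 3 * (K : ℝ) ^ 2 * Real.log n ≤ 3 * (2 * (Λ * x)) ^ 2 * (2 * x ^ 2) := by gcongr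
      _ = 24 * Λ ^ 2 * x ^ 4 := by ring
      _ ≤ 168 * Λ ^ 3 * n := by
        rw [hxn]
        have : Λ ^ 2 ≤ Λ ^ 3 := pow_le_pow_right₀ hΛ (by norm_num)
        gcongr
        norm_num
  have hB : ∑ p, pivotCost θ p ≤ 42 * Λ ^ 3 * n := (sum_pivotCost_le_sq θ).trans (by linarith)
  have main := quicksort_avgDisplacement θ hs0 hT0.le hK'
  have e : 2 * T / n = 336 * Λ ^ 3 := by
    rw [hT]; field_simp; norm_num
  rw [e] at main
  refine le_trans (tsub_le_tsub_left (ENNReal.ofReal_le_ofReal ?_) 1) main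
  rw [hsT, Real.exp_log hn0, ← Real.exp_add, ← hsT]
  have hlast : 2 * s * ∑ p, pivotCost θ p + n * ∑ p, farCost θ K p ≤ s * T / 2 + 1 := by
    refine add_le_add ?_ ?_
    · calc 2 * s * ∑ p, pivotCost θ p ≤ 2 * s * (42 * Λ ^ 3 * n) := by gcongr
        _ = s * T / 2 := by rw [hT]; ring
    · calc n * ∑ p, farCost θ K p ≤ n * (1 / n) := by gcongr
        _ = 1 := by field_simp
  have hsq : Real.exp (s * T / 2) = x ^ 2 := by
    rw [hsT, ← hxn, show x ^ 4 = (x ^ 2) ^ 2 by ring, Real.log_pow]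
    push_cast
    rw [mul_div_cancel_left₀ _ two_ne_zero, Real.exp_log (by positivity)]
  rw [← hsq, ← Real.exp_sub]
  exact Real.exp_le_exp.2 (by linarith)

variable {Ω : Type*} {mΩ : MeasurableSpace Ω} {P : Measure Ω}

lemma measure_sumAbove_sq_le [IsProbabilityMeasure P] (hn : 1 ≤ n) {rate : ℝ} (hrate : 0 < rate)
    {θ : Ω → Fin n → ℝ} (hy : IsFactorSequence P fun k ω => factor (gap (θ ω)) k)
    (hlaw : ∀ i, HasLaw (fun ω => gap (θ ω) i) (expMeasure rate) P) :
    P.real {ω | 14 * (max 1 rate) ^ 3 * n < ∑ j, sumAbove (θ ω) j ^ 2} ≤ 625 / n := by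
  obtain ⟨N, rfl⟩ : ∃ N, n = N + 1 := ⟨n - 1, by omega⟩
  have h := hy.measure_sum_chain_sq_le (Λ := max 1 rate) (le_max_left _ _)
    (fun k => by simpa using
      integral_factor_pow_le (X := fun ω => gap (θ ω)) hrate hlaw 2 (by norm_num) k)
    (fun k => by simpa using
      integral_factor_pow_le (X := fun ω => gap (θ ω)) hrate hlaw 4 (by norm_num) k) N
  simp only [sum_sumAbove_sq]
  push_cast
  exact h

/-- The probability of a misplacement by `K` ranks decays geometrically in `K`, at rate
`Λ / (1 + Λ)`; it is bounded by a power of the number of items. -/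
lemma measure_farCost_le [IsProbabilityMeasure P] (hn : 1 ≤ n) {rate : ℝ} (hrate : 0 < rate)
    {θ : Ω → Fin n → ℝ} (hy : IsFactorSequence P fun k ω => factor (gap (θ ω)) k)
    (hlaw : ∀ i, HasLaw (fun ω => gap (θ ω) i) (expMeasure rate) P) {x : ℝ} (hx : 0 < x)
    (hxn : x ^ 4 = n) :
    P.real {ω | 1 / n ≤ ∑ p, farCost (θ ω) ⌈max 1 rate * x⌉₊ p} ≤
      2 ^ 17 * (Nat.factorial 16) / n := by
  set Λ := max 1 rate with hΛdef
  have hΛ : 1 ≤ Λ := le_max_left _ _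
  set K := ⌈Λ * x⌉₊ with hKdef
  have hn0 : (0 : ℝ) < n := by exact_mod_cast hn
  have hK0 : 0 < K := Nat.ceil_pos.2 (by positivity)
  set m : ℝ := 1 - 1 / (Λ + 1) with hm
  have hm0 : 0 ≤ m := by
    rw [hm, sub_nonneg, div_le_one (by positivity)]; linarith
  have hm1 : m ≤ 1 := by
    rw [hm]; linarith [show (0 : ℝ) ≤ 1 / (Λ + 1) by positivity]
  have hmk : ∀ k, ∫ ω, factor (gap (θ ω)) k ∂P ≤ m := fun k => by
    simpa [hm, hΛdef] using
      integral_factor_pow_le (X := fun ω => gap (θ ω)) hrate hlaw 1 one_pos k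
  have hterm : ∀ p i : Fin n,
      Integrable (fun ω => if K ≤ (p : ℕ) - i then Real.exp (θ ω p - θ ω i) else 0) P ∧
      ∫ ω, (if K ≤ (p : ℕ) - i then Real.exp (θ ω p - θ ω i) else 0) ∂P ≤ m ^ K := by
    intro p i
    split_ifs with h
    · have hip : i ≤ p := Fin.le_def.2 (by omega)
      simp only [exp_sub_eq_prod_factor _ hip]
      exact ⟨(hy.bddPast_prod hip).integrable hy,
        (hy.integral_prod_le hm0 hmk hip).trans (pow_le_pow_of_le_one hm0 hm1 h)⟩
    · exact ⟨integrable_zero _ _ _, by simp; positivity⟩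
  have hint : ∫ ω, ∑ p, farCost (θ ω) K p ∂P ≤ 2 * (n * (n * m ^ K)) := by
    simp only [sum_farCost_eq]
    rw [integral_const_mul, integral_finsetSum _ fun p _ => integrable_finsetSum _ fun i _ =>
      (hterm p i).1]
    refine mul_le_mul_of_nonneg_left ?_ (by norm_num)
    refine (Finset.sum_le_card_nsmul _ _ (n * m ^ K) fun p _ => ?_).trans_eq (by simp)
    rw [integral_finsetSum _ fun i _ => (hterm p i).1]
    exact (Finset.sum_le_card_nsmul _ _ (m ^ K) fun i _ => (hterm p i).2).trans_eq (by simp)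
  have hintegrable : Integrable (fun ω => ∑ p, farCost (θ ω) K p) P := by
    simp only [sum_farCost_eq]
    exact (integrable_finsetSum _ fun p _ => integrable_finsetSum _ fun i _ =>
      (hterm p i).1).const_mul 2
  have hmarkov := (mul_meas_ge_le_integral_of_nonneg
    (Filter.Eventually.of_forall fun ω => Finset.sum_nonneg fun p _ => farCost_nonneg (θ ω) K p)
    hintegrable (1 / (n : ℝ))).trans hint
  have hmK : m ^ K ≤ 2 ^ 16 * (Nat.factorial 16) / (n : ℝ) ^ 4 := by
    have h1 : m ≤ Real.exp (-(1 / (2 * Λ))) := by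
      have h2 := Real.add_one_le_exp (-(1 / (2 * Λ)))
      have h3 : 1 / (2 * Λ) ≤ 1 / (Λ + 1) := one_div_le_one_div_of_le (by positivity) (by linarith)
      linarith
    have h4 : m ^ K ≤ Real.exp (-(x / 2)) := by
      refine (pow_le_pow_left₀ hm0 h1 K).trans ?_
      rw [← Real.exp_nat_mul]
      refine Real.exp_le_exp.2 ?_
      have h5 : Λ * x ≤ K := Nat.le_ceil _
      have h6 : Λ * x * (1 / (2 * Λ)) ≤ K * (1 / (2 * Λ)) := by gcongr
      have h7 : Λ * x * (1 / (2 * Λ)) = x / 2 := by field_simp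
      linarith
    refine h4.trans ?_
    have h8 := Real.pow_div_factorial_le_exp (x / 2) (by positivity) 16
    rw [Real.exp_neg, ← hxn, inv_le_comm₀ (Real.exp_pos _) (by positivity)]
    refine le_trans (le_of_eq ?_) h8
    rw [inv_div, div_pow, div_div]
    congr 1
    ring
  have hfin : 1 / (n : ℝ) * P.real {ω | 1 / n ≤ ∑ p, farCost (θ ω) K p} ≤
      1 / (n : ℝ) * (2 ^ 17 * (Nat.factorial 16) / n) := by
    refine hmarkov.trans ?_
    calc 2 * (n * (n * m ^ K)) ≤ 2 * (n * (n * (2 ^ 16 * (Nat.factorial 16) / (n : ℝ) ^ 4))) := by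
          gcongr
      _ = _ := by field_simp
  exact le_of_mul_le_mul_left hfin (by positivity)

lemma measure_goodParameters [IsProbabilityMeasure P] (hn : 1 ≤ n) {rate : ℝ} (hrate : 0 < rate)
    {θ : Ω → Fin n → ℝ} (hθ : Measurable θ)
    (hind : iIndepFun (fun (i : Fin (n - 1)) (ω : Ω) => gap (θ ω) i) P)
    (hlaw : ∀ i, HasLaw (fun ω => gap (θ ω) i) (expMeasure rate) P) {x : ℝ} (hx : 0 < x)
    (hxn : x ^ 4 = n) :
    1 - (1250 + 2 ^ 17 * (Nat.factorial 16)) / n ≤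
      P.real (θ ⁻¹' goodParameters n (max 1 rate) ⌈max 1 rate * x⌉₊) := by
  have hmeas : ∀ i, Measurable fun ω => gap (θ ω) i := fun i => by
    unfold gap
    fun_prop
  have hy := isFactorSequence_factor (X := fun ω => gap (θ ω)) hmeas hind hlaw
  have hlaw' : ∀ i, HasLaw (fun ω => gap (mirror (θ ω)) i) (expMeasure rate) P := fun i => by
    simpa only [gap_mirror] using hlaw i.rev
  have hy' : IsFactorSequence P fun k ω => factor (gap (mirror (θ ω))) k := by
    refine isFactorSequence_factor (X := fun ω => gap (mirror (θ ω))) ?_ ?_ hlaw'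
    · intro i
      simpa only [gap_mirror] using hmeas i.rev
    · simp only [gap_mirror]
      exact hind.precomp Fin.rev_injective
  have h1 := measure_sumAbove_sq_le hn hrate hy hlaw
  have h2 := measure_sumAbove_sq_le (θ := fun ω => mirror (θ ω)) hn hrate hy' hlaw'
  have h3 := measure_farCost_le hn hrate hy hlaw hx hxn
  simp only [← sum_sumBelow_sq] at h2
  set K := ⌈max 1 rate * x⌉₊
  have hc := probReal_compl_eq_one_sub (μ := P) (hθ (measurableSet_goodParameters (max 1 rate) K))
  have hsub : (θ ⁻¹' goodParameters n (max 1 rate) K)ᶜ ⊆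
      {ω | 14 * (max 1 rate) ^ 3 * n < ∑ j, sumAbove (θ ω) j ^ 2} ∪
      {ω | 14 * (max 1 rate) ^ 3 * n < ∑ j, sumBelow (θ ω) j ^ 2} ∪
      {ω | 1 / n ≤ ∑ p, farCost (θ ω) K p} := by
    intro ω hω
    by_contra hnot
    simp only [Set.mem_union, Set.mem_ofPred_eq, not_or, not_lt, not_le] at hnot
    exact hω ⟨⟨hnot.1.1, hnot.1.2⟩, hnot.2.le⟩
  have hle := (measureReal_mono hsub (measure_ne_top P _)).trans ((measureReal_union_le _ _).trans
    (add_le_add (measureReal_union_le _ _) le_rfl))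
  have e : (1250 + 2 ^ 17 * (Nat.factorial 16 : ℝ)) / n =
      625 / n + 625 / n + 2 ^ 17 * (Nat.factorial 16) / n := by ring
  rw [e]
  linarith

end Good

end NoisySort

open NoisySort in
theorem mainTheorem1 :
    ∃ C c α : ℝ, 0 < C ∧ 0 < c ∧ 0 < α ∧
      ∀ (rate : ℝ) (_ : 0 < rate) (n : ℕ) (_ : 1 ≤ n)
        {Ω : Type*} [MeasurableSpace Ω] (P : Measure Ω) [IsProbabilityMeasure P]
        (θ : Ω → Fin n → ℝ) (_ : Measurable θ)
        (_ : iIndepFun (fun (i : Fin (n - 1)) (ω : Ω) => gap (θ ω) i) P)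
        (_ : ∀ i : Fin (n - 1), HasLaw (fun ω => gap (θ ω) i) (expMeasure rate) P),
        ENNReal.ofReal (1 - c / (n : ℝ) ^ α) ≤
          quicksortProb P θ (fun l => avgDisplacement l ≤ C * (max 1 rate) ^ 3) := by
  refine ⟨336, 1250 + 2 ^ 17 * (Nat.factorial 16) + Real.exp 1, 1 / 2, by norm_num, by positivity,
    by norm_num, ?_⟩
  intro rate hrate n hn Ω _ P _ θ hθ hind hlaw
  set c₁ : ℝ := 1250 + 2 ^ 17 * (Nat.factorial 16)
  have hn1 : (1 : ℝ) ≤ n := by exact_mod_cast hn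
  have hn0 : (0 : ℝ) < n := by linarith
  set x : ℝ := (n : ℝ) ^ (1 / 4 : ℝ) with hxdef
  have hx : 0 < x := by positivity
  have hx2 : x ^ 2 = (n : ℝ) ^ (1 / 2 : ℝ) := by
    rw [hxdef, ← Real.rpow_natCast, ← Real.rpow_mul hn0.le]
    norm_num
  have hxn : x ^ 4 = n := by
    rw [hxdef, ← Real.rpow_natCast, ← Real.rpow_mul hn0.le]
    norm_num
  have hgood := measure_goodParameters hn hrate hθ hind hlaw hx hxn
  set S := θ ⁻¹' goodParameters n (max 1 rate) ⌈max 1 rate * x⌉₊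
  have hS : MeasurableSet S := hθ (measurableSet_goodParameters _ _)
  set δ := Real.exp 1 / x ^ 2 with hδ
  have hδ0 : 0 ≤ δ := by positivity
  calc ENNReal.ofReal (1 - (c₁ + Real.exp 1) / (n : ℝ) ^ (1 / 2 : ℝ))
      ≤ ENNReal.ofReal (1 - δ) * ENNReal.ofReal (P.real S) := by
        have hx1 : 1 ≤ x := Real.one_le_rpow hn1 (by norm_num)
        have h1 : c₁ / n ≤ c₁ / x ^ 2 := by
          rw [← hxn]
          have : x ^ 2 ≤ x ^ 4 := pow_le_pow_right₀ hx1 (by norm_num)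
          gcongr
        have hP1 : P.real S ≤ 1 := measureReal_le_one
        have hP0 : 0 ≤ P.real S := measureReal_nonneg
        have h2 : 1 - (c₁ + Real.exp 1) / x ^ 2 ≤ P.real S - δ := by
          rw [add_div, hδ]
          linarith
        rw [← hx2]
        rcases le_total δ 1 with hδ1 | hδ1
        · rw [← ENNReal.ofReal_mul (by linarith)]
          refine ENNReal.ofReal_le_ofReal (h2.trans ?_)
          nlinarith
        · rw [ENNReal.ofReal_of_nonpos (by linarith)]
          exact zero_le
    _ = ∫⁻ _ in S, (1 - ENNReal.ofReal δ) ∂P := by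
        rw [setLIntegral_const, ofReal_measureReal, ENNReal.ofReal_sub _ hδ0, ENNReal.ofReal_one]
    _ ≤ ∫⁻ ω in S, (quicksort (btCompare (θ ω)) (List.finRange n)).toOuterMeasure
          {l | avgDisplacement l ≤ 336 * (max 1 rate) ^ 3} ∂P :=
        setLIntegral_mono' hS fun ω hω =>
          quicksort_of_goodParameters hn (le_max_left _ _) hx hxn hω
    _ ≤ _ := setLIntegral_le_lintegral _ _
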